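/- For an open, possibly unbounded, interval $\tilde J\subset\mathbb R$ let $\mathbb C_{\tilde J}=(\mathbb C\setminus\mathbb R)\cup\tilde J$. An orientation preserving homeomorphism $g:I=[0,a]\to J=g(I)$ of real intervals is in the Epstein class if it extends to a three-fold analytic branched covering, also denoted $g$, of an open simply connected domain $G\subset\mathbb C$, $G\supset I$, onto $\mathbb C_{\tilde J}$ for some such $\tilde J\supset J$, with its only branch point at $0$. For $s\in(0,1)$ let $\mathcal E_s$ be the set of those $g$ for which $$ s\le \frac{|I|}{|J|}\le s^{-1},\qquad s\le\frac{\operatorname{dist}(I,J)}{|J|}\le s^{-1}, $$ each component of $\tilde J\setminus J$ has length at least $s|J|$, and $g'(a)>s$; let $\overline{\mathcal E}_s\supset\mathcal E_s$ be the set defined in the same way with $g'(a)\ge s$ in place of $g'(a)>s$. Each such map is regarded as a triple $(G,0,g)$ with marked domain $(G,0)$. A sequence of triples $(U_n,u_n,f_n)$ converges to $(U,u,f)$ if the marked domains converge in the sense of Carathéodory ($u_n\to u\in U$ and, for every Hausdorff limit point $K$ of the sequence $\hat{\mathbb C}\setminus U_n$, the set $U$ is a connected component of $\hat{\mathbb C}\setminus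 K$), and $f_n\to f$ locally uniformly on $U$ (every compact subset of $U$ lies in $U_n$ for all large $n$, and $f_n\to f$ uniformly on it). Let $s\in(0,1)$. Then every sequence of maps in $\mathcal E_s$ with $I=[0,1]$ has a subsequence that converges to a map in $\overline{\mathcal E}_s$ with $I=[0,1]$. Moreover, the set of maps in $\overline{\mathcal E}_s$ with $I=[0,1]$ is sequentially compact: every sequence in it has a subsequence that converges to an element of it. -/

import Mathlib

open Set Filter Topology MeasureTheory

namespace Epstein

/-- A triple `(U, u, f)`: a domain `U ⊆ ℂ`, a marked point `u`, and a map `f` of which only the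
values on `U` matter. -/
structure MarkedMap where
  dom : Set ℂ
  pt : ℂ
  map : ℂ → ℂ

/-- The plane `ℂ_J = (ℂ \ ℝ) ∪ J`. -/
def slitPlane (J : Set ℝ) : Set ℂ :=
  {z | z.im ≠ 0} ∪ (fun x : ℝ => (x : ℂ)) '' J

/-- `f : U → V` is a `d`-fold analytic branched covering map (a proper holomorphic map which takes
every value in `V` exactly `d` times, counted with multiplicity). -/
structure IsBranchedCovering (d : ℕ) (f : ℂ → ℂ) (U V : Set ℂ) : Prop where
  analytic : DifferentiableOn ℂ f U
  mapsTo : MapsTo f U V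
  proper : ∀ L ⊆ V, IsCompact L → IsCompact (U ∩ f ⁻¹' L)
  degree : ∀ w ∈ V,
    ∑ᶠ z ∈ {z | z ∈ U ∧ f z = w}, analyticOrderNatAt (fun x => f x - w) z = d

/-- The orientation preserving homeomorphism `g : I = [0,a] → J = g(I)` extends to a three-fold
analytic branched covering `f` of the topological disk `G ⊇ I` onto the slit plane of the open,
possibly unbounded, interval `Jt ⊇ J`, with its only branch point at `0`. -/
structure IsEpsteinMap (a : ℝ) (g : ℝ → ℝ) (Jt : Set ℝ) (G : Set ℂ) (f : ℂ → ℂ) : Prop where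
  ne_zero : a ≠ 0
  strictMono : StrictMonoOn g (uIcc 0 a)
  continuousOn : ContinuousOn g (uIcc 0 a)
  isOpen_range : IsOpen Jt
  interval_range : Jt.OrdConnected
  image_subset : g '' uIcc 0 a ⊆ Jt
  isOpen_dom : IsOpen G
  simplyConnected_dom : IsSimplyConnected G
  subset_dom : ∀ x ∈ uIcc 0 a, (x : ℂ) ∈ G
  extends_map : ∀ x ∈ uIcc 0 a, f x = g x
  covering : IsBranchedCovering 3 f G (slitPlane Jt)
  branch : ∀ z ∈ G, deriv f z = 0 ↔ z = 0

/-- `x` and `y` are `K`-commensurable. -/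
def Commensurable (K x y : ℝ) : Prop :=
  K⁻¹ ≤ |x| / |y| ∧ |x| / |y| ≤ K

/-- The Euclidean distance between two sets of reals. -/
noncomputable def setDist (A B : Set ℝ) : ℝ :=
  sInf (image2 dist A B)

/-- The metric conditions on `g : I = [0,a] → J ⊆ Jt` in the definition of the class `E_s`, apart
from the condition on the derivative at `a`. -/
structure HasBounds (s a : ℝ) (g : ℝ → ℝ) (Jt : Set ℝ) : Prop where
  length : Commensurable s⁻¹ (Metric.diam (uIcc 0 a)) (Metric.diam (g '' uIcc 0 a))
  distance : Commensurable s⁻¹ (setDist (uIcc 0 a) (g '' uIcc 0 a))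
    (Metric.diam (g '' uIcc 0 a))
  space : ∀ x ∈ Jt \ g '' uIcc 0 a,
    ENNReal.ofReal (s * Metric.diam (g '' uIcc 0 a)) ≤
      volume (connectedComponentIn (Jt \ g '' uIcc 0 a) x)

/-- The maps of the class `E_s` with `I = [0,a]`, as triples `(G, 0, f)`. -/
def epsteinClass (s a : ℝ) : Set MarkedMap :=
  {T | T.pt = 0 ∧ ∃ (g : ℝ → ℝ) (Jt : Set ℝ), IsEpsteinMap a g Jt T.dom T.map ∧
    HasBounds s a g Jt ∧ s < derivWithin g (uIcc 0 a) a}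

/-- The same class with `g'(a) ≥ s` in place of `g'(a) > s`. -/
def closedEpsteinClass (s a : ℝ) : Set MarkedMap :=
  {T | T.pt = 0 ∧ ∃ (g : ℝ → ℝ) (Jt : Set ℝ), IsEpsteinMap a g Jt T.dom T.map ∧
    HasBounds s a g Jt ∧ s ≤ derivWithin g (uIcc 0 a) a}

/-- The complement of `U ⊆ ℂ` in the Riemann sphere. -/
def sphereCompl (U : Set ℂ) : Set (OnePoint ℂ) :=
  ((fun z : ℂ => (z : OnePoint ℂ)) '' U)ᶜ

/-- `K` is a Hausdorff limit point of the sequence `A` of compact subsets of the Riemann sphere: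
`K` is compact and some subsequence of `A` converges to `K`. On the nonempty compact subsets of the
sphere the Vietoris topology is the topology of the Hausdorff distance. -/
def IsHausdorffLimitPoint (A : ℕ → Set (OnePoint ℂ)) (K : Set (OnePoint ℂ)) : Prop :=
  IsCompact K ∧ ∃ φ : ℕ → ℕ, StrictMono φ ∧
    Tendsto (A ∘ φ) atTop (@nhds _ (TopologicalSpace.vietoris (OnePoint ℂ)) K)

/-- Carathéodory convergence of the marked regions `(U n, u n)` to `(V, v)`: `u n → v ∈ V` and, for
each Hausdorff limit point `K` of the complements of the `U n` in the sphere, `V` is a connected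
component of the complement of `K`. -/
def CaratheodoryConverges (U : ℕ → Set ℂ) (u : ℕ → ℂ) (V : Set ℂ) (v : ℂ) : Prop :=
  Tendsto u atTop (𝓝 v) ∧ v ∈ V ∧
    ∀ K, IsHausdorffLimitPoint (fun n => sphereCompl (U n)) K →
      (fun z : ℂ => (z : OnePoint ℂ)) '' V = connectedComponentIn Kᶜ (v : OnePoint ℂ)

/-- Convergence of triples: Carathéodory convergence of the marked domains together with locally
uniform convergence of the maps, that is, each compact subset of the limit domain is eventually
contained in the domains of the sequence and the maps converge uniformly on it. -/
def ConvergesTo (T : ℕ → MarkedMap) (S : MarkedMap) : Prop :=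
  CaratheodoryConverges (fun n => (T n).dom) (fun n => (T n).pt) S.dom S.pt ∧
    ∀ L ⊆ S.dom, IsCompact L → (∀ᶠ n in atTop, L ⊆ (T n).dom) ∧
      TendstoUniformlyOn (fun n => (T n).map) S.map atTop L

end Epstein

/-! The branched covering `f : G → slitPlane J` is replaced by a univalent map. Put `c = f 0` and
let `W = rootDomain 3 J c` be the preimage of the slit plane under `ζ ↦ ζ ^ 3 + c`. Since `0` is the
only branch point and the degree is three, `f` lifts through the cubic: there is a biholomorphic `ψ
: W → G` with `ψ 0 = 0` and `f (ψ ζ) = ζ ^ 3 + c` (`exists_uniformization`). A cube root of unity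
can be absorbed so that also `ψ l = 1`, where `l` is the positive cube root of `|J|`. Conversely, a
univalent `ψ` with this normalization, real and monotone on `[0, l]`, gives an Epstein map
(`exists_isEpsteinMap`). A map of the class is thus the endpoints of `J` and of the larger interval
together with a normalized univalent function.

The metric bounds keep the endpoints of `J` in a compact set and its length away from zero; the
endpoints of the larger interval lie in the compact space `EReal`. Along a subsequence all four
converge, and the definite space around `J` keeps the limit of `J` inside the limit of the larger
intervals. The domains `W` then converge too, in the kernel sense.

The `ψ n` form a normal family (`ConvData.evBddAt`). In place of the Koebe theorems this uses a
Harnack inequality: if a univalent `h` omits `v` on a disc, `log (h - v)` cannot take two values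
differing by `2πi`, so its image contains no disc of radius 4, and Bloch's theorem bounds its
derivative. Montel's theorem gives a limit `Ψ`, and Hurwitz's theorem makes it univalent because `Ψ
0 = 0` and `Ψ l' = 1` differ. The inverses converge, hence so do the maps, which are the cubes of
the inverses plus constants.

For Carathéodory convergence, the image of `Ψ` is open, connected and disjoint from each Hausdorff
limit `K` of the complements. It is relatively closed in the complement of `K`: around a boundary
point outside `K` the inverses are defined for all large `n` and again form a normal family, and
their limit shows that the point lies in the image (`ConvData.mem_image_limit_of_mem_closure`). The
remaining conditions are weak inequalities and pass to the limit; only the strict bound on `g'`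
weakens. -/

namespace Epstein

open Metric

/-! ### Bloch's theorem and a Harnack inequality for univalent functions -/

/-- A quantitative form of Bloch's theorem. -/
theorem exists_ball_subset_image_of_lt_norm_deriv {L : ℂ → ℂ} {a : ℂ} {r ρ : ℝ} (hr : 0 < r)
    (hL : DifferentiableOn ℂ L (ball a r)) (hρ : 0 < ρ) (h : 96 * ρ < ‖deriv L a‖ * r) :
    ∃ p, ball p ρ ⊆ L '' ball a r := by
  obtain ⟨t, htr, ht0, ht⟩ : ∃ t < r, 0 < t ∧ 48 * ρ < ‖deriv L a‖ * t := by
    refine ⟨r / 2, by linarith, by linarith, by linarith⟩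
  have hdL : DifferentiableOn ℂ (deriv L) (ball a r) := hL.deriv isOpen_ball
  have hsub : closedBall a t ⊆ ball a r := closedBall_subset_ball htr
  -- Landau's choice of centre: where `(t - dist z a) * ‖deriv L z‖` is largest, the derivative at
  -- most doubles on the disc of radius `R`, half the distance from `p` to the circle of radius `t`.
  obtain ⟨p, hp, hmax⟩ := (isCompact_closedBall a t).exists_isMaxOn
    (f := fun z => (t - dist z a) * ‖deriv L z‖) ⟨a, mem_closedBall_self ht0.le⟩
    ((continuous_const.sub (continuous_id.dist continuous_const)).continuousOn.mul
      (hdL.continuousOn.mono hsub).norm)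
  have hmax' : ∀ z ∈ closedBall a t,
      (t - dist z a) * ‖deriv L z‖ ≤ (t - dist p a) * ‖deriv L p‖ := fun z hz => hmax hz
  set A := ‖deriv L p‖ with hA
  set R := (t - dist p a) / 2 with hR
  have h0 : t * ‖deriv L a‖ ≤ 2 * R * A := by
    have := hmax' a (mem_closedBall_self ht0.le)
    rw [dist_self, sub_zero] at this
    linarith [this, show t - dist p a = 2 * R by rw [hR]; ring, mul_comm (2 * R) A,
      show (t - dist p a) * A = 2 * R * A by rw [hR]; ring]
  have hA0 : 0 ≤ A := norm_nonneg _
  have hpos : 0 < R * A := by nlinarith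
  have hR0 : 0 < R := by
    have : 0 ≤ R := by
      have := mem_closedBall.1 hp
      rw [hR]; linarith
    rcases this.eq_or_lt with h | h
    · rw [← h] at hpos; simp at hpos
    · exact h
  have hApos : 0 < A := by
    rcases hA0.eq_or_lt with h | h
    · rw [← h] at hpos; simp at hpos
    · exact h
  have hballR : ball p R ⊆ closedBall a t := by
    intro z hz
    have h1 := mem_ball.1 hz
    have h2 := dist_triangle z p a
    rw [mem_closedBall]; rw [hR] at h1; have := mem_closedBall.1 hp; linarith
  have hder : ∀ z ∈ ball p R, ‖deriv L z‖ ≤ 2 * A := by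
    intro z hz
    have h1 := mem_ball.1 hz
    have h2 := dist_triangle z p a
    have h3 := hmax' z (hballR hz)
    have h4 : R ≤ t - dist z a := by
      have : t - dist p a = 2 * R := by rw [hR]; ring
      linarith
    have h5 : (t - dist p a) * A = R * (2 * A) := by rw [hR]; ring
    have h6 : R * ‖deriv L z‖ ≤ R * (2 * A) := by
      calc R * ‖deriv L z‖ ≤ (t - dist z a) * ‖deriv L z‖ := by gcongr
        _ ≤ _ := by rw [← h5]; exact h3
    exact le_of_mul_le_mul_left h6 hR0
  have hsubR : ball p R ⊆ ball a r := hballR.trans hsub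
  -- By the Schwarz lemma `deriv L` moves by at most `A / 2` within `R / 6` of `p`. There `L` is
  -- close to an affine map of slope `A`, so it moves the circle at least `A * R / 12` away from `L
  -- p` and covers a disc of half that radius. This gives the 48; halving `r` to get `t` makes it
  -- 96.
  have hder2 : ∀ z ∈ closedBall p (R / 6), ‖deriv L z - deriv L p‖ ≤ A / 2 := by
    intro z hz
    have hz1 : dist z p ≤ R / 6 := mem_closedBall.1 hz
    have hmaps : MapsTo (deriv L) (ball p R) (closedBall (deriv L p) (3 * A)) := by
      intro w hw
      rw [mem_closedBall, dist_eq_norm]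
      calc ‖deriv L w - deriv L p‖ ≤ ‖deriv L w‖ + ‖deriv L p‖ := norm_sub_le _ _
        _ ≤ 3 * A := by linarith [hder w hw]
    have := Complex.dist_le_div_mul_dist_of_mapsTo_ball (hdL.mono hsubR) hmaps
      (z := z) (by rw [mem_ball]; linarith)
    rw [dist_eq_norm] at this
    calc _ ≤ 3 * A / R * dist z p := this
      _ ≤ 3 * A / R * (R / 6) := by gcongr
      _ = A / 2 := by field_simp; norm_num
  have hq : closedBall p (R / 6) ⊆ ball p R := closedBall_subset_ball (by linarith)
  have hq' : closedBall p (R / 6) ⊆ ball a r := hq.trans hsubR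
  have hlip : ∀ z ∈ closedBall p (R / 6),
      ‖(L z - deriv L p * z) - (L p - deriv L p * p)‖ ≤ A / 2 * ‖z - p‖ := by
    intro z hz
    refine Convex.norm_image_sub_le_of_norm_hasDerivWithin_le (𝕜 := ℂ)
      (f := fun z => L z - deriv L p * z) (f' := fun z => deriv L z - deriv L p)
      (s := closedBall p (R / 6)) ?_ hder2 (convex_closedBall _ _)
      (mem_closedBall_self (by linarith)) hz
    intro x hx
    have h1 : HasDerivAt L (deriv L x) x :=
      (hL.differentiableAt (isOpen_ball.mem_nhds (hq' hx))).hasDerivAt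
    have h2 : HasDerivAt (fun z => deriv L p * z) (deriv L p) x := by
      simpa using (hasDerivAt_id x).const_mul (deriv L p)
    exact (h1.sub h2).hasDerivWithinAt
  have hR6 : 0 < R / 6 := by linarith
  have hsphere : ∀ z ∈ sphere p (R / 6), A * R / 12 ≤ ‖L z - L p‖ := by
    intro z hz
    have hzp : ‖z - p‖ = R / 6 := by rw [← dist_eq_norm]; exact mem_sphere.1 hz
    have h1 := hlip z (sphere_subset_closedBall hz)
    have h2 : ‖deriv L p * (z - p)‖ = A * (R / 6) := by rw [norm_mul, hzp]
    have h3 : deriv L p * (z - p)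
        = (L z - L p) - ((L z - deriv L p * z) - (L p - deriv L p * p)) := by ring
    have h4 : ‖deriv L p * (z - p)‖ ≤ ‖L z - L p‖
        + ‖(L z - deriv L p * z) - (L p - deriv L p * p)‖ := by
      rw [h3]; exact norm_sub_le _ _
    rw [hzp] at h1
    linarith
  have hfreq : ∃ᶠ z in 𝓝 p, L z ≠ L p := by
    intro hev
    have : deriv L p = 0 := by
      have h1 : L =ᶠ[𝓝 p] fun _ => L p := by
        filter_upwards [hev] with z hz
        simpa using hz
      rw [h1.deriv_eq]; simp
    rw [hA, this, norm_zero] at hApos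
    exact lt_irrefl _ hApos
  have hdc : DiffContOnCl ℂ L (ball p (R / 6)) := by
    refine DifferentiableOn.diffContOnCl ?_
    rw [closure_ball p hR6.ne']
    exact hL.mono hq'
  have := hdc.ball_subset_image_closedBall hR6 hsphere hfreq
  refine ⟨L p, (ball_subset_ball ?_).trans (this.trans (image_mono hq'))⟩
  have : 48 * ρ < 2 * R * A := by linarith [mul_comm t ‖deriv L a‖]
  linarith

/-- On a disk, a nowhere vanishing holomorphic function has a holomorphic logarithm. -/
theorem exists_log_of_ne_zero {h : ℂ → ℂ} {a : ℂ} {r : ℝ} (hr : 0 < r)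
    (hh : DifferentiableOn ℂ h (ball a r)) (h0 : ∀ z ∈ ball a r, h z ≠ 0) :
    ∃ L : ℂ → ℂ, L a = 0 ∧ DifferentiableOn ℂ L (ball a r) ∧
      ∀ z ∈ ball a r, h z = h a * Complex.exp (L z) := by
  have hq : DifferentiableOn ℂ (fun z => deriv h z / h z) (ball a r) :=
    (hh.deriv isOpen_ball).div hh h0
  obtain ⟨L, hLa, hL⟩ := hq.isExactOn_ball.with_val_at a 0
  have hLd : DifferentiableOn ℂ L (ball a r) := fun z hz =>
    (hL z hz).differentiableAt.differentiableWithinAt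
  refine ⟨L, hLa, hLd, fun z hz => ?_⟩
  have hder : ∀ x ∈ ball a r,
      HasDerivWithinAt (fun z => h z * Complex.exp (-L z)) 0 (ball a r) x := by
    intro x hx
    have h1 : HasDerivAt h (deriv h x) x :=
      (hh.differentiableAt (isOpen_ball.mem_nhds hx)).hasDerivAt
    have h2 := (h1.mul (hL x hx).neg.cexp).hasDerivWithinAt (s := ball a r)
    refine h2.congr_deriv ?_
    have h3 : h x * (deriv h x / h x) = deriv h x := mul_div_cancel₀ _ (h0 x hx)
    linear_combination (-Complex.exp (-L x)) * h3
  have hconst := (convex_ball a r).norm_image_sub_le_of_norm_hasDerivWithin_le (𝕜 := ℂ)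
    (C := 0) hder (by simp) (mem_ball_self hr) hz
  simp only [zero_mul, norm_le_zero_iff, sub_eq_zero, hLa, neg_zero, Complex.exp_zero,
    mul_one] at hconst
  rw [← hconst, mul_assoc, ← Complex.exp_add]
  simp

/-- A Harnack inequality for univalent functions on a disk that omit a value. -/
theorem norm_sub_le_of_injOn_of_omits {h : ℂ → ℂ} {a v : ℂ} {r : ℝ}
    (hh : DifferentiableOn ℂ h (ball a r)) (hinj : InjOn h (ball a r))
    (hv : ∀ z ∈ ball a r, h z ≠ v) {z : ℂ} (hz : z ∈ ball a (r / 2)) :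
    ‖h z - v‖ ≤ Real.exp 384 * ‖h a - v‖ := by
  have hr : 0 < r := by
    have := pos_of_mem_ball hz
    linarith
  obtain ⟨L, hLa, hL, hexp⟩ := exists_log_of_ne_zero hr (hh.sub_const v)
    (fun z hz => sub_ne_zero.2 (hv z hz))
  -- Since `4 > π`, a disc of radius 4 contains two points differing by `2πi`; their exponentials
  -- agree, which contradicts injectivity of `h`. The number 768 below is `96 * 4` divided by one
  -- half, for discs of radius `r / 2`.
  have hno : ∀ p, ¬ ball p 4 ⊆ L '' ball a r := by
    intro p hp
    have hpi := Real.pi_lt_d2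
    have hpi0 := Real.pi_pos
    obtain ⟨x, hx, hx'⟩ := hp (show p + Real.pi * Complex.I ∈ ball p 4 by
      simp [abs_of_pos hpi0]; linarith)
    obtain ⟨y, hy, hy'⟩ := hp (show p - Real.pi * Complex.I ∈ ball p 4 by
      simp [abs_of_pos hpi0]; linarith)
    have hxy : L x = L y + 2 * Real.pi * Complex.I := by rw [hx', hy']; ring
    have : h x = h y := by
      have h1 := hexp x hx
      have h2 := hexp y hy
      rw [hxy, Complex.exp_add, Complex.exp_two_pi_mul_I, mul_one, ← h2] at h1
      simpa using h1
    have := hinj hx hy this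
    rw [this] at hxy
    simp at hxy
  have hbound : ∀ w ∈ ball a (r / 2), ‖deriv L w‖ ≤ 768 / r := by
    intro w hw
    by_contra hlt
    push Not at hlt
    have hsub : ball w (r / 2) ⊆ ball a r :=
      ball_subset_ball' (by have := mem_ball.1 hw; linarith)
    obtain ⟨p, hp⟩ := exists_ball_subset_image_of_lt_norm_deriv (ρ := 4) (half_pos hr)
      (hL.mono hsub) (by norm_num) (by
        rw [div_lt_iff₀ hr] at hlt
        linarith)
    exact hno p (hp.trans (image_mono hsub))
  have hsub : ball a (r / 2) ⊆ ball a r := ball_subset_ball (by linarith)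
  have hLz : ‖L z - L a‖ ≤ 768 / r * ‖z - a‖ :=
    (convex_ball a (r / 2)).norm_image_sub_le_of_norm_deriv_le (𝕜 := ℂ)
      (fun x hx => hL.differentiableAt (isOpen_ball.mem_nhds (hsub hx))) hbound
      (mem_ball_self (half_pos hr)) hz
  have hLw : ‖L z‖ ≤ 384 := by
    rw [hLa, sub_zero] at hLz
    calc ‖L z‖ ≤ 768 / r * ‖z - a‖ := hLz
      _ ≤ 768 / r * (r / 2) := by
        gcongr
        rw [← dist_eq_norm]; exact (mem_ball.1 hz).le
      _ = 384 := by field_simp; norm_num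
  rw [hexp z (hsub hz), norm_mul, mul_comm]
  gcongr
  rw [Complex.norm_exp]
  exact Real.exp_le_exp.2 ((Complex.re_le_norm _).trans hLw)

/-! ### Continuous convergence and Montel's theorem for varying domains -/

/-- The sequence `F` converges continuously to `G` at `z`. -/
def ContConvAt (F : ℕ → ℂ → ℂ) (G : ℂ → ℂ) (z : ℂ) : Prop :=
  Tendsto (fun p : ℕ × ℂ => F p.1 p.2) (atTop ×ˢ 𝓝 z) (𝓝 (G z))

theorem ContConvAt.tendsto {F : ℕ → ℂ → ℂ} {G : ℂ → ℂ} {z : ℂ} (h : ContConvAt F G z)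
    {u : ℕ → ℂ} (hu : Tendsto u atTop (𝓝 z)) : Tendsto (fun n => F n (u n)) atTop (𝓝 (G z)) :=
  h.comp (tendsto_id.prodMk hu)

theorem ContConvAt.comp_strictMono {F : ℕ → ℂ → ℂ} {G : ℂ → ℂ} {z : ℂ} (h : ContConvAt F G z)
    {φ : ℕ → ℕ} (hφ : StrictMono φ) : ContConvAt (fun n => F (φ n)) G z :=
  Tendsto.comp h ((hφ.tendsto_atTop.comp tendsto_fst).prodMk tendsto_snd)

theorem ContConvAt.exists_ball {F : ℕ → ℂ → ℂ} {G : ℂ → ℂ} {z : ℂ} (h : ContConvAt F G z)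
    {ε : ℝ} (hε : 0 < ε) : ∃ r > 0, ∀ᶠ n in atTop, ∀ x ∈ ball z r, dist (F n x) (G z) < ε := by
  have h1 : ∀ᶠ p : ℕ × ℂ in atTop ×ˢ 𝓝 z, dist (F p.1 p.2) (G z) < ε :=
    h (ball_mem_nhds _ hε)
  obtain ⟨P, hP, Q, hQ, hPQ⟩ := eventually_prod_iff.1 h1
  obtain ⟨r, hr, hr'⟩ := Metric.eventually_nhds_iff_ball.1 hQ
  exact ⟨r, hr, hP.mono fun n hn x hx => hPQ hn (hr' x hx)⟩

theorem continuousOn_of_contConvAt {F : ℕ → ℂ → ℂ} {G : ℂ → ℂ} {U : Set ℂ}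
    (h : ∀ z ∈ U, ContConvAt F G z) : ContinuousOn G U := by
  intro z hz
  rw [Metric.continuousWithinAt_iff]
  intro ε hε
  obtain ⟨r, hr, h1⟩ := (h z hz).exists_ball (half_pos hε)
  refine ⟨r, hr, fun x hx hxz => ?_⟩
  have h2 : Tendsto (fun n => dist (F n x) (G z)) atTop (𝓝 (dist (G x) (G z))) :=
    ((h x hx).tendsto tendsto_const_nhds).dist tendsto_const_nhds
  have := le_of_tendsto h2 (h1.mono fun n hn => (hn x (mem_ball.2 hxz)).le)
  linarith

theorem tendstoLocallyUniformlyOn_of_contConvAt {F : ℕ → ℂ → ℂ} {G : ℂ → ℂ} {U : Set ℂ}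
    (h : ∀ z ∈ U, ContConvAt F G z) : TendstoLocallyUniformlyOn F G atTop U := by
  rw [Metric.tendstoLocallyUniformlyOn_iff]
  intro ε hε z hz
  obtain ⟨r, hr, h1⟩ := (h z hz).exists_ball (half_pos hε)
  have hc := Metric.continuousWithinAt_iff.1 (continuousOn_of_contConvAt h z hz) _ (half_pos hε)
  obtain ⟨δ, hδ, hc⟩ := hc
  refine ⟨U ∩ ball z (min r δ), inter_mem_nhdsWithin _ (ball_mem_nhds _ (lt_min hr hδ)), ?_⟩
  filter_upwards [h1] with n hn x hx
  have hx2 := mem_ball.1 hx.2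
  have h3 := hn x (mem_ball.2 (hx2.trans_le (min_le_left _ _)))
  have h4 := hc hx.1 (hx2.trans_le (min_le_right _ _))
  have := dist_triangle_right (G x) (F n x) (G z)
  linarith

/-- A sequence of functions that are eventually holomorphic on a neighbourhood of `z`. -/
def EvDiffAt (F : ℕ → ℂ → ℂ) (z : ℂ) : Prop :=
  ∃ r > 0, ∀ᶠ n in atTop, DifferentiableOn ℂ (F n) (ball z r)

theorem differentiableAt_of_contConvAt {F : ℕ → ℂ → ℂ} {G : ℂ → ℂ} {U : Set ℂ} (hU : IsOpen U)
    (h : ∀ z ∈ U, ContConvAt F G z) {z : ℂ} (hz : z ∈ U) (hd : EvDiffAt F z) :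
    DifferentiableAt ℂ G z ∧ Tendsto (fun n => deriv (F n) z) atTop (𝓝 (deriv G z)) := by
  obtain ⟨r, hr, hd⟩ := hd
  obtain ⟨δ, hδ, hδU⟩ := Metric.isOpen_iff.1 hU z hz
  have hb : ∀ x ∈ ball z (min r δ), ContConvAt F G x := fun x hx =>
    h x (hδU (ball_subset_ball (min_le_right _ _) hx))
  have hl := tendstoLocallyUniformlyOn_of_contConvAt hb
  have hd' : ∀ᶠ n in atTop, DifferentiableOn ℂ (F n) (ball z (min r δ)) :=
    hd.mono fun n hn => hn.mono (ball_subset_ball (min_le_left _ _))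
  have hz' : z ∈ ball z (min r δ) := mem_ball_self (lt_min hr hδ)
  exact ⟨(hl.differentiableOn hd' isOpen_ball).differentiableAt (isOpen_ball.mem_nhds hz'),
    (hl.deriv hd' isOpen_ball).tendsto_at hz'⟩

theorem differentiableOn_of_contConvAt {F : ℕ → ℂ → ℂ} {G : ℂ → ℂ} {U : Set ℂ} (hU : IsOpen U)
    (h : ∀ z ∈ U, ContConvAt F G z) (hd : ∀ z ∈ U, EvDiffAt F z) : DifferentiableOn ℂ G U :=
  fun z hz => (differentiableAt_of_contConvAt hU h hz (hd z hz)).1.differentiableWithinAt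

/-- The sequence `F` is eventually holomorphic and bounded on a neighbourhood of `z`. -/
def EvBddAt (F : ℕ → ℂ → ℂ) (z : ℂ) : Prop :=
  ∃ r > 0, ∃ M : ℝ, ∀ᶠ n in atTop, DifferentiableOn ℂ (F n) (ball z r) ∧
    ∀ x ∈ ball z r, ‖F n x‖ ≤ M

/-- **Montel's theorem**, for functions whose domains may vary along the sequence. -/
theorem exists_subseq_contConvAt {F : ℕ → ℂ → ℂ} {U : Set ℂ} (hU : IsOpen U)
    (hF : ∀ z ∈ U, EvBddAt F z) :
    ∃ φ : ℕ → ℕ, StrictMono φ ∧ ∃ G : ℂ → ℂ, ∀ z ∈ U, ContConvAt (fun n => F (φ n)) G z := by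
  let q : ℕ → ℂ := TopologicalSpace.denseSeq ℂ
  have hM : ∀ k, ∃ M : ℝ, 0 ≤ M ∧ (q k ∈ U → ∀ᶠ n in atTop, ‖F n (q k)‖ ≤ M) := by
    intro k
    by_cases hk : q k ∈ U
    · obtain ⟨r, hr, M, h⟩ := hF _ hk
      refine ⟨|M|, abs_nonneg _, fun _ => h.mono fun n hn => ?_⟩
      exact (hn.2 _ (mem_ball_self hr)).trans (le_abs_self _)
    · exact ⟨0, le_rfl, fun h => absurd h hk⟩
  choose M hM0 hM using hM
  -- The bound at `q k` holds only for large `n`; replacing the other values by `0` puts every row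
  -- in a compact product, and Tychonoff's theorem takes the place of the diagonal argument.
  let x : ℕ → ℕ → ℂ := fun n k => if ‖F n (q k)‖ ≤ M k then F n (q k) else 0
  have hx : ∀ n, x n ∈ Set.pi univ (fun k => closedBall (0 : ℂ) (M k)) := by
    intro n k _
    simp only [x]
    split_ifs with h
    · simpa using h
    · simpa using hM0 k
  obtain ⟨a, -, φ, hφ, ha⟩ := (isCompact_univ_pi fun k => isCompact_closedBall (0 : ℂ) (M k)).tendsto_subseq hx
  rw [tendsto_pi_nhds] at ha
  have hq : ∀ k, q k ∈ U → Tendsto (fun n => F (φ n) (q k)) atTop (𝓝 (a k)) := by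
    intro k hk
    refine (ha k).congr' ?_
    filter_upwards [hφ.tendsto_atTop.eventually (hM k hk)] with n hn
    simp [x, hn]
  -- The Schwarz lemma turns local bounds into a local Lipschitz bound uniform in `n`, which carries
  -- convergence from the dense sequence to all of `U`.
  have hlip : ∀ z ∈ U, ∃ r > 0, ∃ K ≥ 0, ∀ᶠ n in atTop, ∀ y ∈ ball z r,
      dist (F (φ n) y) (F (φ n) z) ≤ K * dist y z := by
    intro z hz
    obtain ⟨r, hr, M, h⟩ := hF z hz
    refine ⟨r, hr, 2 * |M| / r, by positivity, ?_⟩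
    filter_upwards [hφ.tendsto_atTop.eventually h] with n hn y hy
    refine Complex.dist_le_div_mul_dist_of_mapsTo_ball hn.1 (fun w hw => ?_) hy
    rw [mem_closedBall, dist_eq_norm]
    have h1 := hn.2 w hw
    have h2 := hn.2 z (mem_ball_self hr)
    have h3 := le_abs_self M
    linarith [norm_sub_le (F (φ n) w) (F (φ n) z)]
  have hcauchy : ∀ z ∈ U, ∃ b, Tendsto (fun n => F (φ n) z) atTop (𝓝 b) := by
    intro z hz
    refine cauchySeq_tendsto_of_complete (Metric.cauchySeq_iff.2 fun ε hε => ?_)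
    obtain ⟨r, hr, K, hK, h⟩ := hlip z hz
    obtain ⟨δ, hδ, hδU⟩ := Metric.isOpen_iff.1 hU z hz
    have hpos : 0 < min (min r δ) (ε / (4 * (K + 1))) := by positivity
    obtain ⟨k, hk⟩ := (TopologicalSpace.denseRange_denseSeq ℂ).exists_mem_open isOpen_ball
      ⟨z, mem_ball_self hpos⟩
    have hk' : dist (q k) z < min (min r δ) (ε / (4 * (K + 1))) := hk
    have hkU : q k ∈ U := hδU (mem_ball.2
      (hk'.trans_le ((min_le_left _ _).trans (min_le_right _ _))))
    have hkr : q k ∈ ball z r := mem_ball.2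
      (hk'.trans_le ((min_le_left _ _).trans (min_le_left _ _)))
    have hkε : K * dist (q k) z ≤ ε / 4 := by
      have h1 : dist (q k) z ≤ ε / (4 * (K + 1)) := (hk'.trans_le (min_le_right _ _)).le
      calc K * dist (q k) z ≤ (K + 1) * (ε / (4 * (K + 1))) := by gcongr; linarith
        _ = ε / 4 := by field_simp
    obtain ⟨N, hN⟩ := Metric.cauchySeq_iff.1 (hq k hkU).cauchySeq (ε / 2) (half_pos hε)
    obtain ⟨N', hN'⟩ := eventually_atTop.1 h
    refine ⟨max N N', fun m hm n hn => ?_⟩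
    have h1 := hN m (le_of_max_le_left hm) n (le_of_max_le_left hn)
    have h2 := hN' m (le_of_max_le_right hm) _ hkr
    have h3 := hN' n (le_of_max_le_right hn) _ hkr
    have h4 := dist_triangle4_left (F (φ m) (q k)) (F (φ n) (q k)) (F (φ m) z) (F (φ n) z)
    linarith
  choose! G hG using hcauchy
  refine ⟨φ, hφ, G, fun z hz => ?_⟩
  obtain ⟨r, hr, K, hK, h⟩ := hlip z hz
  have h1 : Tendsto (fun p : ℕ × ℂ => K * dist p.2 z + dist (F (φ p.1) z) (G z))
      (atTop ×ˢ 𝓝 z) (𝓝 0) := by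
    have h2 : Tendsto (fun p : ℕ × ℂ => dist p.2 z) (atTop ×ˢ 𝓝 z) (𝓝 0) :=
      (tendsto_iff_dist_tendsto_zero.1 tendsto_id).comp tendsto_snd
    have h3 : Tendsto (fun p : ℕ × ℂ => dist (F (φ p.1) z) (G z)) (atTop ×ˢ 𝓝 z) (𝓝 0) :=
      (tendsto_iff_dist_tendsto_zero.1 (hG z hz)).comp tendsto_fst
    simpa using (h2.const_mul K).add h3
  refine tendsto_iff_dist_tendsto_zero.2 (squeeze_zero' (Eventually.of_forall fun _ => dist_nonneg)
    ?_ h1)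
  filter_upwards [h.prod_mk (ball_mem_nhds z hr)] with p hp
  exact (dist_triangle _ (F (φ p.1) z) _).trans (by gcongr; exact hp.1 p.2 hp.2)

/-! ### Hurwitz's theorem and convergence of inverses -/

/-- The sequence `F` is eventually holomorphic and injective on a neighbourhood of `z`. -/
def EvInjAt (F : ℕ → ℂ → ℂ) (z : ℂ) : Prop :=
  ∃ r > 0, ∀ᶠ n in atTop, DifferentiableOn ℂ (F n) (ball z r) ∧ InjOn (F n) (ball z r)

theorem EvInjAt.evDiffAt {F : ℕ → ℂ → ℂ} {z : ℂ} (h : EvInjAt F z) : EvDiffAt F z := by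
  obtain ⟨r, hr, h⟩ := h
  exact ⟨r, hr, h.mono fun n hn => hn.1⟩

/-- A stable form of the open mapping theorem. -/
theorem exists_ball_subset_image_closedBall {F : ℕ → ℂ → ℂ} {G : ℂ → ℂ} {U : Set ℂ}
    (hU : IsOpen U) (h : ∀ z ∈ U, ContConvAt F G z) {z : ℂ} (hz : z ∈ U) (hF : EvInjAt F z)
    (hG : ∀ᶠ x in 𝓝[≠] z, G x ≠ G z) {r : ℝ} (hr : 0 < r) :
    ∃ ε > 0, ∀ᶠ n in atTop, ball (G z) ε ⊆ F n '' closedBall z r := by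
  obtain ⟨r₁, hr₁, hF⟩ := hF
  obtain ⟨δ, hδ, hδU⟩ := Metric.isOpen_iff.1 hU z hz
  obtain ⟨η, hη, hηG⟩ := Metric.eventually_nhds_iff_ball.1 (eventually_nhdsWithin_iff.1 hG)
  obtain ⟨t, ht, ht'⟩ : ∃ t > 0, t < min (min r r₁) (min δ η) :=
    exists_between (lt_min (lt_min hr hr₁) (lt_min hδ hη))
  have htr : t < r := ht'.trans_le ((min_le_left _ _).trans (min_le_left _ _))
  have htr₁ : t < r₁ := ht'.trans_le ((min_le_left _ _).trans (min_le_right _ _))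
  have htδ : t < δ := ht'.trans_le ((min_le_right _ _).trans (min_le_left _ _))
  have htη : t < η := ht'.trans_le ((min_le_right _ _).trans (min_le_right _ _))
  have hsubU : closedBall z t ⊆ U := (closedBall_subset_ball htδ).trans hδU
  have hcont : ContinuousOn G (closedBall z t) := (continuousOn_of_contConvAt h).mono hsubU
  obtain ⟨w, hw, hmin⟩ := (isCompact_sphere z t).exists_isMinOn
    (NormedSpace.sphere_nonempty.2 ht.le) (f := fun x => ‖G x - G z‖)
    ((hcont.mono sphere_subset_closedBall).sub continuousOn_const).norm
  have hwpos : 0 < ‖G w - G z‖ := by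
    rw [norm_pos_iff, sub_ne_zero]
    exact hηG w (mem_ball.2 ((mem_sphere.1 hw).trans_lt htη)) (ne_of_mem_sphere hw ht.ne')
  set m := ‖G w - G z‖ with hm
  have hunif := (tendstoLocallyUniformlyOn_iff_tendstoUniformlyOn_of_compact
    (isCompact_closedBall z t)).1
    ((tendstoLocallyUniformlyOn_of_contConvAt h).mono hsubU)
  rw [Metric.tendstoUniformlyOn_iff] at hunif
  -- With `F n` within `m / 8` of `G`, the circle stays at least `m / 2` from `F n z`. So `F n`
  -- covers the disc of radius `m / 4` about `F n z`, which contains the disc of radius `m / 8`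
  -- about `G z`.
  refine ⟨m / 8, by positivity, ?_⟩
  filter_upwards [hunif (m / 8) (by positivity), hF] with n hn hFn
  have hzz : z ∈ closedBall z t := mem_closedBall_self ht.le
  have hball : closedBall z t ⊆ ball z r₁ := closedBall_subset_ball htr₁
  have hsph : ∀ x ∈ sphere z t, m / 2 ≤ ‖F n x - F n z‖ := by
    intro x hx
    have h1 : m ≤ ‖G x - G z‖ := hmin hx
    have h2 := hn x (sphere_subset_closedBall hx)
    have h3 := hn z hzz
    rw [← dist_eq_norm] at h1 ⊢
    have h4 := dist_triangle4 (G x) (F n x) (F n z) (G z)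
    rw [dist_comm (F n z) (G z)] at h4
    linarith
  have hfreq : ∃ᶠ x in 𝓝 z, F n x ≠ F n z := by
    intro hev
    have h1 : ∀ᶠ x in 𝓝[≠] z, False := by
      filter_upwards [nhdsWithin_le_nhds hev, self_mem_nhdsWithin,
        nhdsWithin_le_nhds (ball_mem_nhds z hr₁)] with x hx hxz hxb
      exact hxz (hFn.2 hxb (mem_ball_self hr₁) (not_not.1 hx))
    exact (NeBot.ne inferInstance) (eventually_false_iff_eq_bot.1 h1)
  have hdc : DiffContOnCl ℂ (F n) (ball z t) := by
    refine DifferentiableOn.diffContOnCl ?_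
    rw [closure_ball z ht.ne']
    exact hFn.1.mono hball
  have hsub := hdc.ball_subset_image_closedBall ht hsph hfreq
  refine Subset.trans (Subset.trans (ball_subset_ball' ?_) hsub)
    (image_mono (closedBall_subset_closedBall htr.le))
  have := hn z hzz
  linarith

/-- **Hurwitz's theorem** on limits of univalent functions. -/
theorem injOn_of_contConvAt {F : ℕ → ℂ → ℂ} {G : ℂ → ℂ} {U : Set ℂ} (hU : IsOpen U)
    (h : ∀ z ∈ U, ContConvAt F G z)
    (hF : ∀ K ⊆ U, IsCompact K → ∀ᶠ n in atTop, InjOn (F n) K)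
    (hF' : ∀ z ∈ U, EvInjAt F z)
    (hG : ∀ z ∈ U, ∀ᶠ x in 𝓝[≠] z, G x ≠ G z) : InjOn G U := by
  intro x hx y hy hxy
  by_contra hne
  obtain ⟨δ, hδ, hδU⟩ := Metric.isOpen_iff.1 hU x hx
  obtain ⟨η, hη, hηU⟩ := Metric.isOpen_iff.1 hU y hy
  have hd : 0 < dist x y := dist_pos.2 hne
  -- The discs about `x` and `y` are disjoint as `t < dist x y / 2`, yet for large `n` both images
  -- under `F n` contain the common value `G x = G y`.
  obtain ⟨t, ht, ht'⟩ : ∃ t > 0, t < min (min δ η) (dist x y / 2) :=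
    exists_between (lt_min (lt_min hδ hη) (half_pos hd))
  have hx' : closedBall x t ⊆ U := (closedBall_subset_ball
    (ht'.trans_le ((min_le_left _ _).trans (min_le_left _ _)))).trans hδU
  have hy' : closedBall y t ⊆ U := (closedBall_subset_ball
    (ht'.trans_le ((min_le_left _ _).trans (min_le_right _ _)))).trans hηU
  obtain ⟨ε, hε, h1⟩ := exists_ball_subset_image_closedBall hU h hx (hF' x hx) (hG x hx) ht
  obtain ⟨ε', hε', h2⟩ := exists_ball_subset_image_closedBall hU h hy (hF' y hy) (hG y hy) ht
  obtain ⟨n, h1, h2, h3⟩ := (h1.and (h2.and (hF _ (union_subset hx' hy')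
    ((isCompact_closedBall x t).union (isCompact_closedBall y t))))).exists
  obtain ⟨p, hp, hp'⟩ := h1 (mem_ball_self hε)
  obtain ⟨q, hq, hq'⟩ := h2 (mem_ball_self hε')
  have hpq : p = q := h3 (Or.inl hp) (Or.inr hq) (by rw [hp', hq', hxy])
  subst hpq
  have := dist_triangle_left x y p
  have h5 := mem_closedBall.1 hp
  have h6 := mem_closedBall.1 hq
  have h7 := ht'.trans_le (min_le_right _ _)
  linarith

/-- The inverses of a convergent sequence of univalent functions converge. -/
theorem tendsto_inverse_of_contConvAt {F P : ℕ → ℂ → ℂ} {G : ℂ → ℂ} {U : Set ℂ}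
    (hU : IsOpen U) (h : ∀ z ∈ U, ContConvAt F G z) {z : ℂ} (hz : z ∈ U) (hF : EvInjAt F z)
    (hG : ∀ᶠ x in 𝓝[≠] z, G x ≠ G z)
    (hP : ∃ r > 0, ∀ᶠ n in atTop, ∀ x ∈ ball z r, P n (F n x) = x) :
    Tendsto (fun p : ℕ × ℂ => P p.1 p.2) (atTop ×ˢ 𝓝 (G z)) (𝓝 z) := by
  obtain ⟨r, hr, hP⟩ := hP
  refine Metric.tendsto_nhds.2 fun ε hε => ?_
  obtain ⟨t, ht, ht'⟩ : ∃ t > 0, t < min r ε := exists_between (lt_min hr hε)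
  obtain ⟨δ, hδ, h1⟩ := exists_ball_subset_image_closedBall hU h hz hF hG ht
  filter_upwards [(h1.and hP).prod_mk (ball_mem_nhds (G z) hδ)] with p hp
  obtain ⟨x, hx, hx'⟩ := hp.1.1 hp.2
  have hx1 := mem_closedBall.1 hx
  rw [← hx', hp.1.2 x (mem_ball.2 (hx1.trans_lt (ht'.trans_le (min_le_left _ _))))]
  exact hx1.trans_lt (ht'.trans_le (min_le_right _ _))

/-! ### Univalent functions and their inverses -/

theorem eventually_ne_of_injOn {h : ℂ → ℂ} {U : Set ℂ} (hU : IsOpen U) (hinj : InjOn h U)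
    {z : ℂ} (hz : z ∈ U) : ∀ᶠ x in 𝓝[≠] z, h x ≠ h z := by
  filter_upwards [self_mem_nhdsWithin, nhdsWithin_le_nhds (hU.mem_nhds hz)] with x hx hxU hxz
  exact hx (hinj hxU hz hxz)

theorem isOpen_image_of_injOn {h : ℂ → ℂ} {U V : Set ℂ} (hU : IsOpen U)
    (hd : DifferentiableOn ℂ h U) (hinj : InjOn h U) (hV : IsOpen V) (hVU : V ⊆ U) :
    IsOpen (h '' V) := by
  rw [isOpen_iff_mem_nhds]
  rintro _ ⟨z, hz, rfl⟩
  have ha : AnalyticAt ℂ h z := hd.analyticAt (hU.mem_nhds (hVU hz))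
  rcases ha.eventually_constant_or_nhds_le_map_nhds_aux with h1 | h1
  · have h2 : ∀ᶠ x in 𝓝[≠] z, False := by
      filter_upwards [nhdsWithin_le_nhds h1, eventually_ne_of_injOn hU hinj (hVU hz)]
        with x hx hx' using hx' hx
    exact ((NeBot.ne inferInstance) (eventually_false_iff_eq_bot.1 h2)).elim
  · exact h1 (image_mem_map (hV.mem_nhds hz))

theorem continuousOn_inverse {h P : ℂ → ℂ} {U : Set ℂ} (hU : IsOpen U)
    (hd : DifferentiableOn ℂ h U) (hinj : InjOn h U) (hP : ∀ x ∈ U, P (h x) = x) :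
    ContinuousOn P (h '' U) := by
  rintro _ ⟨z, hz, rfl⟩
  refine ContinuousAt.continuousWithinAt ?_
  rw [ContinuousAt, hP z hz]
  intro V hV
  obtain ⟨V', hV', hV'o, hzV'⟩ := _root_.mem_nhds_iff.1 (inter_mem hV (hU.mem_nhds hz))
  have hV'U : V' ⊆ U := hV'.trans inter_subset_right
  rw [mem_map]
  refine mem_of_superset ((isOpen_image_of_injOn hU hd hinj hV'o hV'U).mem_nhds
    (mem_image_of_mem h hzV')) ?_
  rintro _ ⟨x, hx, rfl⟩
  rw [mem_preimage, hP x (hV'U hx)]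
  exact (hV' hx).1

/-- The inverse is continuous by the open mapping theorem and holomorphic where `deriv h` does not
vanish. Zeros of the derivative are isolated, so the remaining points are removable singularities.
That there are in fact no zeros then follows from the chain rule in `deriv_mul_deriv_inverse`. -/
theorem differentiableOn_inverse {h P : ℂ → ℂ} {U : Set ℂ} (hU : IsOpen U)
    (hd : DifferentiableOn ℂ h U) (hinj : InjOn h U) (hP : ∀ x ∈ U, P (h x) = x) :
    DifferentiableOn ℂ P (h '' U) := by
  have hc := continuousOn_inverse hU hd hinj hP
  have ho := isOpen_image_of_injOn hU hd hinj hU subset_rfl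
  have hreg : ∀ z ∈ U, deriv h z ≠ 0 → DifferentiableAt ℂ P (h z) := by
    intro z hz hz'
    refine (HasDerivAt.of_local_left_inverse (f := h) (f' := deriv h z)
      (hc.continuousAt (ho.mem_nhds (mem_image_of_mem h hz))) ?_ hz' ?_).differentiableAt
    · rw [hP z hz]
      exact (hd.differentiableAt (hU.mem_nhds hz)).hasDerivAt
    · filter_upwards [ho.mem_nhds (mem_image_of_mem h hz)]
      rintro _ ⟨x, hx, rfl⟩
      rw [hP x hx]
  rintro _ ⟨z, hz, rfl⟩
  refine DifferentiableAt.differentiableWithinAt ?_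
  have hda : AnalyticAt ℂ (deriv h) z := (hd.deriv hU).analyticAt (hU.mem_nhds hz)
  have hne : ∀ᶠ x in 𝓝[≠] z, deriv h x ≠ 0 := by
    refine hda.eventually_eq_zero_or_eventually_ne_zero.resolve_left fun h0 => ?_
    obtain ⟨r, hr, h0⟩ := Metric.eventually_nhds_iff_ball.1 (h0.and (hU.mem_nhds hz))
    have hz1 : z + (r / 2 : ℝ) ∈ ball z r := by
      simp [abs_of_pos hr]; linarith
    have := (convex_ball z r).norm_image_sub_le_of_norm_deriv_le (𝕜 := ℂ) (C := 0)
      (fun x hx => hd.differentiableAt (hU.mem_nhds (h0 x hx).2))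
      (fun x hx => by simp [(h0 x hx).1]) (mem_ball_self hr) hz1
    simp only [zero_mul, norm_le_zero_iff, sub_eq_zero] at this
    have := hinj (h0 _ hz1).2 hz this
    simp at this
    exact hr.ne' this
  obtain ⟨V, hV, hVo, hzV⟩ := _root_.mem_nhds_iff.1
    (inter_mem (eventually_nhdsWithin_iff.1 hne) (hU.mem_nhds hz))
  have hVU : V ⊆ U := fun x hx => (hV hx).2
  have hVo' := isOpen_image_of_injOn hU hd hinj hVo hVU
  have hmem := hVo'.mem_nhds (mem_image_of_mem h hzV)
  refine ((Complex.differentiableOn_compl_singleton_and_continuousAt_iff hmem).1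
    ⟨?_, hc.continuousAt (ho.mem_nhds (mem_image_of_mem h hz))⟩).differentiableAt hmem
  rintro _ ⟨⟨x, hx, rfl⟩, hxz⟩
  refine (hreg x (hVU hx) ((hV hx).1 fun hxz' => hxz (by rw [hxz']; rfl))).differentiableWithinAt

theorem deriv_mul_deriv_inverse {h P : ℂ → ℂ} {U : Set ℂ} (hU : IsOpen U)
    (hd : DifferentiableOn ℂ h U) (hinj : InjOn h U) (hP : ∀ x ∈ U, P (h x) = x)
    {z : ℂ} (hz : z ∈ U) : deriv P (h z) * deriv h z = 1 := by
  have ho := isOpen_image_of_injOn hU hd hinj hU subset_rfl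
  have h1 := ((differentiableOn_inverse hU hd hinj hP).differentiableAt
    (ho.mem_nhds (mem_image_of_mem h hz))).hasDerivAt
  have h2 := (hd.differentiableAt (hU.mem_nhds hz)).hasDerivAt
  have h3 : HasDerivAt (P ∘ h) 1 z := by
    refine (hasDerivAt_id z).congr_of_eventuallyEq ?_
    filter_upwards [hU.mem_nhds hz] with x hx using hP x hx
  exact (h1.comp z h2).unique h3

/-! ### Slit planes and their preimages under power maps -/

theorem mem_slitPlane {J : Set ℝ} {z : ℂ} : z ∈ slitPlane J ↔ z.im ≠ 0 ∨ z.re ∈ J := by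
  constructor
  · rintro (h | ⟨x, hx, rfl⟩)
    · exact Or.inl h
    · exact Or.inr (by simpa using hx)
  · intro h
    by_cases hz : z.im = 0
    · exact Or.inr ⟨z.re, h.resolve_left (not_not.2 hz), Complex.ext (by simp) (by simp [hz])⟩
    · exact Or.inl hz

theorem isOpen_slitPlane {J : Set ℝ} (hJ : IsOpen J) : IsOpen (slitPlane J) := by
  have : slitPlane J = Complex.im ⁻¹' {0}ᶜ ∪ Complex.re ⁻¹' J := by
    ext z
    simp [mem_slitPlane]
  rw [this]
  exact (isOpen_compl_singleton.preimage Complex.continuous_im).union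
    (hJ.preimage Complex.continuous_re)

/-- The preimage of `slitPlane J` under `ζ ↦ ζ ^ m + c`. -/
def rootDomain (m : ℕ) (J : Set ℝ) (c : ℝ) : Set ℂ :=
  {ζ | ζ ^ m + c ∈ slitPlane J}

theorem isOpen_rootDomain (m : ℕ) {J : Set ℝ} (hJ : IsOpen J) (c : ℝ) :
    IsOpen (rootDomain m J c) :=
  (isOpen_slitPlane hJ).preimage (by fun_prop)

theorem zero_mem_rootDomain {m : ℕ} (hm : m ≠ 0) {J : Set ℝ} {c : ℝ} (hc : c ∈ J) :
    (0 : ℂ) ∈ rootDomain m J c := by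
  simp [rootDomain, mem_slitPlane, hm, hc]

/-- Scaling `ζ` by `t` scales `ζ ^ m` by `t ^ m ∈ [0, 1]`. A nonreal value stays nonreal for `t >
0`, and a real value of `ζ ^ m + c` moves towards `c` inside the interval `J`. -/
theorem smul_mem_rootDomain {m : ℕ} (hm : m ≠ 0) {J : Set ℝ} (hJ : J.OrdConnected) {c : ℝ}
    (hc : c ∈ J) {ζ : ℂ} (hζ : ζ ∈ rootDomain m J c) {t : ℝ} (ht0 : 0 ≤ t) (ht1 : t ≤ 1) :
    (t : ℂ) * ζ ∈ rootDomain m J c := by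
  have hpow : ((t : ℂ) * ζ) ^ m = ((t ^ m : ℝ) : ℂ) * ζ ^ m := by rw [mul_pow]; push_cast; ring
  have h0 : 0 ≤ t ^ m := pow_nonneg ht0 m
  have h1 : t ^ m ≤ 1 := pow_le_one₀ ht0 ht1
  simp only [rootDomain, Set.mem_ofPred_eq, mem_slitPlane, hpow] at hζ ⊢
  simp only [Complex.add_im, Complex.ofReal_im, add_zero, Complex.add_re, Complex.ofReal_re,
    Complex.im_ofReal_mul, Complex.re_ofReal_mul] at hζ ⊢
  rcases ht0.eq_or_lt with rfl | ht
  · right; simpa [hm] using hc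
  · rcases hζ with h | h
    · left
      exact mul_ne_zero (pow_pos ht m).ne' h
    · right
      refine hJ.uIcc_subset hc h ?_
      rw [mem_uIcc]
      rcases le_total 0 (ζ ^ m).re with h2 | h2
      · left; constructor <;> nlinarith
      · right; constructor <;> nlinarith

theorem starConvex_rootDomain {m : ℕ} (hm : m ≠ 0) {J : Set ℝ} (hJ : J.OrdConnected) {c : ℝ}
    (hc : c ∈ J) : StarConvex ℝ 0 (rootDomain m J c) := by
  rw [starConvex_zero_iff]
  intro ζ hζ t ht0 ht1
  simpa using smul_mem_rootDomain hm hJ hc hζ ht0 ht1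

/-! ### Lifting a branched covering through a power map -/

theorem exists_local_root {f : ℂ → ℂ} {c : ℂ} {G : Set ℂ} (hG : G ∈ 𝓝 (0 : ℂ))
    (hf : AnalyticAt ℂ f 0) (hne : analyticOrderAt (fun z => f z - c) 0 ≠ ⊤)
    (hm : analyticOrderNatAt (fun z => f z - c) 0 ≠ 0) :
    ∃ ε > 0, ∃ ψ : ℂ → ℂ, ContinuousOn ψ (ball 0 ε) ∧ ψ 0 = 0 ∧ MapsTo ψ (ball 0 ε) G ∧
      ∀ ζ ∈ ball (0 : ℂ) ε, f (ψ ζ) = ζ ^ analyticOrderNatAt (fun z => f z - c) 0 + c := by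
  set m := analyticOrderNatAt (fun z => f z - c) 0
  have hfc : AnalyticAt ℂ (fun z => f z - c) 0 := hf.sub analyticAt_const
  obtain ⟨h, hh, hh0, hfh⟩ := (hfc.analyticOrderNatAt_eq_iff hne).1 (rfl : m = m)
  obtain ⟨a, ha⟩ := IsAlgClosed.exists_pow_nat_eq (h 0) (Nat.pos_of_ne_zero hm)
  have hmc : (m : ℂ) ≠ 0 := by exact_mod_cast hm
  have hq : AnalyticAt ℂ (fun z => h z / h 0) 0 := hh.div analyticAt_const hh0
  -- `k` is an `m`-th root of `h` near `0`, where `f z - c = z ^ m * h z`. Hence `p z = z * k z`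
  -- satisfies `p ^ m = f - c` and is locally invertible; the section is its inverse.
  let k : ℂ → ℂ := fun z => a * Complex.exp (Complex.log (h z / h 0) / m)
  have hk : AnalyticAt ℂ k 0 := by
    refine analyticAt_const.mul ?_
    refine AnalyticAt.cexp ?_
    refine AnalyticAt.div (hq.clog ?_) analyticAt_const hmc
    rw [div_self hh0]
    exact Complex.one_mem_slitPlane
  have hkm : ∀ᶠ z in 𝓝 0, k z ^ m = h z := by
    filter_upwards [hh.continuousAt.eventually_ne hh0] with z hz
    simp only [k]
    rw [mul_pow, ha, ← Complex.exp_nat_mul, mul_div_cancel₀ _ hmc,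
      Complex.exp_log (div_ne_zero hz hh0), mul_div_cancel₀ _ hh0]
  have ha0 : a ≠ 0 := by
    rintro rfl
    rw [zero_pow hm] at ha
    exact hh0 ha.symm
  have hk0 : k 0 ≠ 0 := mul_ne_zero ha0 (Complex.exp_ne_zero _)
  let p : ℂ → ℂ := fun z => z * k z
  have hp : HasStrictDerivAt p (k 0) 0 := by
    have h1 : AnalyticAt ℂ p 0 := analyticAt_id.mul hk
    have h2 : HasDerivAt p (1 * k 0 + 0 * deriv k 0) 0 :=
      (hasDerivAt_id (0 : ℂ)).mul hk.differentiableAt.hasDerivAt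
    have h3 := h1.hasStrictDerivAt
    rw [h2.deriv] at h3
    simpa using h3
  let R := (hp.hasStrictFDerivAt_equiv hk0).toOpenPartialHomeomorph p
  have hRp : (R : ℂ → ℂ) = p := rfl
  have hsrc : (0 : ℂ) ∈ R.source :=
    (hp.hasStrictFDerivAt_equiv hk0).mem_toOpenPartialHomeomorph_source
  have hp0 : R 0 = 0 := by rw [hRp]; simp [p]
  have htgt : (0 : ℂ) ∈ R.target := by
    have := R.map_source hsrc
    rwa [hp0] at this
  have hsymm0 : R.symm 0 = 0 := by
    have := R.left_inv hsrc
    rwa [hp0] at this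
  have hcont : Tendsto R.symm (𝓝 0) (𝓝 0) := by
    have := R.continuousAt_symm htgt
    rwa [ContinuousAt, hsymm0] at this
  have hev := (R.open_target.eventually_mem htgt).and
    (hcont.eventually ((hkm.and hfh).and (eventually_mem_set.2 hG)))
  obtain ⟨ε, hε, hball⟩ := Metric.eventually_nhds_iff_ball.1 hev
  refine ⟨ε, hε, R.symm, R.continuousOn_symm.mono fun z hz => (hball z hz).1, hsymm0,
    fun z hz => (hball z hz).2.2, fun z hz => ?_⟩
  obtain ⟨h1, ⟨h2, h3⟩, h4⟩ := hball z hz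
  have h5 : p (R.symm z) = z := R.right_inv h1
  have h6 : R.symm z * k (R.symm z) = z := h5
  rw [sub_zero, smul_eq_mul, ← h2, ← mul_pow, h6] at h3
  linear_combination h3

theorem isLocalHomeomorphOn_of_deriv_ne_zero {f : ℂ → ℂ} {s : Set ℂ}
    (h : ∀ z ∈ s, AnalyticAt ℂ f z ∧ deriv f z ≠ 0) : IsLocalHomeomorphOn f s := by
  intro z hz
  have hd := (h z hz).1.hasStrictDerivAt
  exact ⟨(hd.hasStrictFDerivAt_equiv (h z hz).2).toOpenPartialHomeomorph f,
    (hd.hasStrictFDerivAt_equiv (h z hz).2).mem_toOpenPartialHomeomorph_source, rfl⟩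

/-- Away from its critical values, a proper holomorphic map is a covering map. -/
theorem isCoveringMap_restrict {f : ℂ → ℂ} {G V : Set ℂ} {c : ℂ} (hG : IsOpen G) (hV : IsOpen V)
    (hd : DifferentiableOn ℂ f G) (hmaps : MapsTo f G V)
    (hproper : ∀ L ⊆ V, IsCompact L → IsCompact (G ∩ f ⁻¹' L))
    (hder : ∀ z ∈ G, f z ≠ c → deriv f z ≠ 0) :
    IsCoveringMap (fun z : {z // z ∈ G ∧ f z ≠ c} =>
      (⟨f z, hmaps z.2.1, z.2.2⟩ : {w // w ∈ V ∧ w ≠ c})) := by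
  set p : {z // z ∈ G ∧ f z ≠ c} → {w // w ∈ V ∧ w ≠ c} :=
    fun z => ⟨f z, hmaps z.2.1, z.2.2⟩ with hp
  have hEo : IsOpen {z | z ∈ G ∧ f z ≠ c} :=
    hd.continuousOn.isOpen_inter_preimage hG isOpen_compl_singleton
  have hXo : IsOpen {w | w ∈ V ∧ w ≠ c} := hV.inter isOpen_compl_singleton
  have hcont : Continuous p := by
    refine Continuous.subtype_mk ?_ _
    exact (hd.continuousOn.mono fun z hz => hz.1).domRestrict
  have hloc : IsLocalHomeomorph p := by
    have h1 : IsLocalHomeomorph (Subtype.val : {w // w ∈ V ∧ w ≠ c} → ℂ) :=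
      hXo.isOpenEmbedding_subtypeVal.isLocalHomeomorph
    have h2 : IsLocalHomeomorph (Subtype.val : {z // z ∈ G ∧ f z ≠ c} → ℂ) :=
      hEo.isOpenEmbedding_subtypeVal.isLocalHomeomorph
    have h3 : IsLocalHomeomorphOn f {z | z ∈ G ∧ f z ≠ c} :=
      isLocalHomeomorphOn_of_deriv_ne_zero fun z hz =>
        ⟨hd.analyticAt (hG.mem_nhds hz.1), hder z hz.1 hz.2⟩
    refine IsLocalHomeomorph.of_comp (g := Subtype.val) ?_ h1 hcont
    exact isLocalHomeomorph_iff_isLocalHomeomorphOn_univ.2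
      (h3.comp h2.isLocalHomeomorphOn fun z _ => z.2)
  have : LocallyCompactSpace {w // w ∈ V ∧ w ≠ c} := hXo.locallyCompactSpace
  have hprop : IsProperMap p := by
    refine isProperMap_iff_isCompact_preimage.2 ⟨hcont, fun K hK => ?_⟩
    have hK' : IsCompact (Subtype.val '' K) := hK.image continuous_subtype_val
    have h1 := hproper _ (by rintro _ ⟨w, -, rfl⟩; exact w.2.1) hK'
    rw [Subtype.isCompact_iff]
    convert h1 using 1
    ext z
    constructor
    · rintro ⟨w, hw, rfl⟩
      exact ⟨w.2.1, ⟨_, hw, rfl⟩⟩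
    · rintro ⟨hz, w, hw, hwz⟩
      have hzc : f z ≠ c := by rw [← hwz]; exact w.2.2
      refine ⟨⟨z, hz, hzc⟩, ?_, rfl⟩
      rw [mem_preimage]
      convert hw
      exact Subtype.ext hwz.symm
  refine isCoveringMap_iff_isCoveringMapOn_univ.2
    (hprop.isClosedMap.isCoveringMapOn_of_isLocalHomeomorphOn (fun x _ => ?_)
      (hloc.isLocalHomeomorphOn.mono (subset_univ _)))
  refine (hprop.isCompact_preimage isCompact_singleton).finite
    (IsDiscrete.of_openPartialHomeomorph p subset_rfl fun e _ => ?_)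
  obtain ⟨φ, hφ, hφ'⟩ := hloc e
  exact ⟨φ, hφ, hφ'.symm⟩

/-- A proper holomorphic map onto a slit plane with a single critical value `c` has a holomorphic
section over the `m`-th root, where `m` is the order of the critical point. -/
theorem exists_continuous_root_section {f : ℂ → ℂ} {G : Set ℂ} {J : Set ℝ} {c : ℝ} {m : ℕ}
    (hm : m ≠ 0) (hJ : IsOpen J) (hJc : J.OrdConnected) (hcJ : c ∈ J) (hG : IsOpen G)
    (hd : DifferentiableOn ℂ f G) (hmaps : MapsTo f G (slitPlane J))
    (hproper : ∀ L ⊆ slitPlane J, IsCompact L → IsCompact (G ∩ f ⁻¹' L))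
    (hder : ∀ z ∈ G, f z ≠ c → deriv f z ≠ 0)
    {ε : ℝ} (hε : 0 < ε) {ψ₀ : ℂ → ℂ} (hψc : ContinuousOn ψ₀ (ball 0 ε)) (hψ0 : ψ₀ 0 = 0)
    (hψG : MapsTo ψ₀ (ball 0 ε) G) (hψ : ∀ ζ ∈ ball (0 : ℂ) ε, f (ψ₀ ζ) = ζ ^ m + c) :
    ∃ ψ : ℂ → ℂ, ContinuousOn ψ (rootDomain m J c) ∧ ψ 0 = 0 ∧ MapsTo ψ (rootDomain m J c) G ∧
      ∀ ζ ∈ rootDomain m J c, f (ψ ζ) = ζ ^ m + c := by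
  have hcov := isCoveringMap_restrict (c := (c : ℂ)) hG (isOpen_slitPlane hJ) hd hmaps hproper hder
  set p : {z // z ∈ G ∧ f z ≠ c} → {w // w ∈ slitPlane J ∧ w ≠ (c : ℂ)} :=
    fun z => ⟨f z, hmaps z.2.1, z.2.2⟩ with hp
  let A := {ζ : ℂ // ζ ∈ rootDomain m J c ∧ ζ ≠ 0}
  have hAo : IsOpen {ζ : ℂ | ζ ∈ rootDomain m J c ∧ ζ ≠ 0} :=
    (isOpen_rootDomain m hJ c).inter isOpen_compl_singleton
  -- `τ ζ` shrinks `ζ` radially into the disc where `ψ₀` is defined. The homotopy `H` goes back out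
  -- along the radius to `ζ`, and its lift, started at `ψ₀ (τ ζ * ζ)`, is the section over the
  -- punctured domain.
  let τ : A → ℝ := fun ζ => ε / (ε + 2 * ‖(ζ : ℂ)‖)
  have hτc : Continuous τ := by
    refine continuous_const.div (by fun_prop) fun ζ => ?_
    positivity
  have hτ0 : ∀ ζ, 0 < τ ζ := fun ζ => by positivity
  have hτ1 : ∀ ζ, τ ζ ≤ 1 := fun ζ => by
    refine div_le_one_of_le₀ ?_ (by positivity)
    linarith [norm_nonneg (ζ : ℂ)]
  have hτε : ∀ ζ, ((τ ζ : ℝ) : ℂ) * ζ ∈ ball (0 : ℂ) ε := fun ζ => by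
    rw [mem_ball_zero_iff, norm_mul, Complex.norm_real, Real.norm_of_nonneg (hτ0 ζ).le]
    have h1 : 0 < ‖(ζ : ℂ)‖ := norm_pos_iff.2 ζ.2.2
    simp only [τ]
    rw [div_mul_eq_mul_div, div_lt_iff₀ (by positivity)]
    nlinarith
  let ρ : unitInterval × A → ℝ := fun q => τ q.2 + q.1 * (1 - τ q.2)
  have hρc : Continuous ρ := by fun_prop
  have hρ0 : ∀ q, 0 < ρ q := fun q => by
    have := hτ0 q.2
    have := mul_nonneg q.1.2.1 (sub_nonneg.2 (hτ1 q.2))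
    simp only [ρ]; linarith
  have hρ1 : ∀ q, ρ q ≤ 1 := fun q => by
    have := mul_le_mul_of_nonneg_right q.1.2.2 (sub_nonneg.2 (hτ1 q.2))
    simp only [ρ]; linarith
  have hpow : ∀ ζ : ℂ, ζ ≠ 0 → ζ ^ m + (c : ℂ) ≠ c := fun ζ hζ h =>
    pow_ne_zero m hζ (by simpa using h)
  let H : C(unitInterval × A, {w // w ∈ slitPlane J ∧ w ≠ (c : ℂ)}) :=
    ⟨fun q => ⟨((ρ q : ℂ) * q.2) ^ m + c,
      smul_mem_rootDomain hm hJc hcJ q.2.2.1 (hρ0 q).le (hρ1 q),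
      hpow _ (mul_ne_zero (by exact_mod_cast (hρ0 q).ne') q.2.2.2)⟩, by
      refine Continuous.subtype_mk ?_ _
      have : Continuous fun q : unitInterval × A => (q.2 : ℂ) :=
        continuous_subtype_val.comp continuous_snd
      exact (((Complex.continuous_ofReal.comp hρc).mul this).pow m).add continuous_const⟩
  have hlift : ∀ ζ ∈ ball (0 : ℂ) ε, ζ ≠ 0 → ψ₀ ζ ∈ G ∧ f (ψ₀ ζ) ≠ c := fun ζ hζ hζ0 =>
    ⟨hψG hζ, by rw [hψ ζ hζ]; exact hpow ζ hζ0⟩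
  let s : C(A, {z // z ∈ G ∧ f z ≠ c}) :=
    ⟨fun ζ => ⟨ψ₀ ((τ ζ : ℂ) * ζ), hlift _ (hτε ζ)
      (mul_ne_zero (by exact_mod_cast (hτ0 ζ).ne') ζ.2.2)⟩, by
      refine Continuous.subtype_mk ?_ _
      exact hψc.comp_continuous ((Complex.continuous_ofReal.comp hτc).mul continuous_subtype_val)
        hτε⟩
  have hH0 : ∀ a, H (0, a) = p (s a) := by
    intro a
    refine Subtype.ext ?_
    have h1 : ρ (0, a) = τ a := by simp [ρ]
    change ((ρ (0, a) : ℂ) * a) ^ m + (c : ℂ) = f (ψ₀ ((τ a : ℂ) * a))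
    rw [h1, hψ _ (hτε a)]
  let Λ := hcov.liftHomotopy H s hH0
  have hΛ : ∀ q, p (Λ q) = H q := fun q => congrFun (hcov.liftHomotopy_lifts H s hH0) q
  have hΛ0 : ∀ a, Λ (0, a) = s a := hcov.liftHomotopy_zero H s hH0
  classical
  let ψ : ℂ → ℂ := fun ζ => if h : ζ ∈ rootDomain m J c ∧ ζ ≠ 0 then (Λ (1, ⟨ζ, h⟩) : ℂ) else 0
  have hψ' : ∀ a : A, ψ a = Λ (1, a) := fun a => dif_pos a.2
  have hψ1 : ∀ a : A, f (ψ a) = (a : ℂ) ^ m + c := by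
    intro a
    have h1 := congrArg Subtype.val (hΛ (1, a))
    have h2 : ρ (1, a) = 1 := by simp [ρ]
    change f (Λ (1, a)) = ((ρ (1, a) : ℂ) * a) ^ m + (c : ℂ) at h1
    rw [hψ', h1, h2]
    simp
  -- For `ζ` in the small disc the whole radial path stays there, so `ψ₀` along it is another lift
  -- with the same start. Uniqueness of lifts gives `ψ = ψ₀`, hence continuity at `0`.
  have hloc : ∀ a : A, (a : ℂ) ∈ ball (0 : ℂ) ε → ψ a = ψ₀ a := by
    intro a ha
    have hmem : ∀ t : unitInterval, (ρ (t, a) : ℂ) * a ∈ ball (0 : ℂ) ε := by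
      intro t
      rw [mem_ball_zero_iff] at ha ⊢
      rw [norm_mul, Complex.norm_real, Real.norm_of_nonneg (hρ0 _).le]
      exact (mul_le_of_le_one_left (norm_nonneg _) (hρ1 _)).trans_lt ha
    have hne : ∀ t : unitInterval, (ρ (t, a) : ℂ) * a ≠ 0 := fun t =>
      mul_ne_zero (by exact_mod_cast (hρ0 _).ne') a.2.2
    let g : unitInterval → {z // z ∈ G ∧ f z ≠ c} := fun t =>
      ⟨ψ₀ ((ρ (t, a) : ℂ) * a), hlift _ (hmem t) (hne t)⟩
    have hρt : Continuous fun t : unitInterval => ρ (t, a) := hρc.comp (by fun_prop)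
    have hg : Continuous g := by
      refine Continuous.subtype_mk ?_ _
      exact hψc.comp_continuous ((Complex.continuous_ofReal.comp hρt).mul continuous_const) hmem
    have hΛt : Continuous fun t : unitInterval => Λ (t, a) := Λ.continuous.comp (by fun_prop)
    have heq := hcov.eq_of_comp_eq hΛt hg (funext fun t => by
      refine (hΛ (t, a)).trans (Subtype.ext ?_)
      exact (hψ _ (hmem t)).symm) 0 (by
        rw [hΛ0]
        refine Subtype.ext ?_
        have h1 : ρ (0, a) = τ a := by simp [ρ]
        change ψ₀ ((τ a : ℂ) * a) = ψ₀ ((ρ (0, a) : ℂ) * a)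
        rw [h1])
    have h1 := congrArg Subtype.val (congrFun heq 1)
    have h2 : ρ (1, a) = 1 := by simp [ρ]
    change (Λ (1, a) : ℂ) = ψ₀ ((ρ (1, a) : ℂ) * a) at h1
    rw [hψ', h1, h2]
    simp
  have hψ00 : ψ 0 = 0 := dif_neg fun h => h.2 rfl
  refine ⟨ψ, ?_, hψ00, ?_, ?_⟩
  · intro ζ hζ
    refine ContinuousAt.continuousWithinAt ?_
    by_cases h0 : ζ = 0
    · subst h0
      have h1 : ψ =ᶠ[𝓝 0] ψ₀ := by
        filter_upwards [ball_mem_nhds (0 : ℂ) hε, (isOpen_rootDomain m hJ c).mem_nhds hζ]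
          with x hx hx'
        by_cases hx0 : x = 0
        · rw [hx0, hψ00, hψ0]
        · exact hloc ⟨x, hx', hx0⟩ hx
      exact (hψc.continuousAt (ball_mem_nhds _ hε)).congr h1.symm
    · have h1 : ContinuousOn ψ {ζ : ℂ | ζ ∈ rootDomain m J c ∧ ζ ≠ 0} := by
        rw [continuousOn_iff_continuous_domRestrict]
        have h2 : Continuous fun a : A => (Λ (1, a) : ℂ) :=
          continuous_subtype_val.comp (Λ.continuous.comp (by fun_prop))
        exact h2.congr fun a => (hψ' a).symm
      exact h1.continuousAt (hAo.mem_nhds ⟨hζ, h0⟩)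
  · intro ζ hζ
    by_cases h0 : ζ = 0
    · subst h0
      rw [hψ00, ← hψ0]
      exact hψG (mem_ball_self hε)
    · have := (Λ (1, ⟨ζ, hζ, h0⟩)).2.1
      rwa [← hψ'] at this
  · intro ζ hζ
    by_cases h0 : ζ = 0
    · subst h0
      have h1 := hψ 0 (mem_ball_self hε)
      rw [hψ0] at h1
      rw [hψ00, h1]
    · exact hψ1 ⟨ζ, hζ, h0⟩

/-- A continuous solution `ψ` of `f ∘ ψ = q` is holomorphic where `f'` does not vanish. -/
theorem differentiableAt_of_comp_eq {f ψ q : ℂ → ℂ} {ζ : ℂ} (hψ : ContinuousAt ψ ζ)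
    (hf : AnalyticAt ℂ f (ψ ζ)) (hf' : deriv f (ψ ζ) ≠ 0) (hq : DifferentiableAt ℂ q ζ)
    (h : ∀ᶠ x in 𝓝 ζ, f (ψ x) = q x) : DifferentiableAt ℂ ψ ζ := by
  have hd := hf.hasStrictDerivAt
  have h1 := (hd.to_localInverse hf').hasDerivAt.differentiableAt
  have h2 := (hd.hasStrictFDerivAt_equiv hf').eventually_left_inverse
  rw [h.self_of_nhds] at h1
  refine (h1.comp ζ hq).congr_of_eventuallyEq ?_
  filter_upwards [h, hψ.eventually h2] with x hx hx'
  rw [Function.comp_apply, ← hx]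
  exact hx'.symm

/-- Off the origin `ψ` is a local inverse of `f` composed with the power map; the origin is a
removable singularity by continuity. -/
theorem differentiableOn_root_section {f ψ : ℂ → ℂ} {G : Set ℂ} {J : Set ℝ} {c : ℝ} {m : ℕ}
    (hm : m ≠ 0) (hJ : IsOpen J) (hcJ : c ∈ J) (hG : IsOpen G) (hd : DifferentiableOn ℂ f G)
    (hder : ∀ z ∈ G, f z ≠ c → deriv f z ≠ 0)
    (hψc : ContinuousOn ψ (rootDomain m J c)) (hψG : MapsTo ψ (rootDomain m J c) G)
    (hψ : ∀ ζ ∈ rootDomain m J c, f (ψ ζ) = ζ ^ m + c) :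
    DifferentiableOn ℂ ψ (rootDomain m J c) := by
  have hWo := isOpen_rootDomain m hJ c
  have h0 := zero_mem_rootDomain hm hcJ
  refine (Complex.differentiableOn_compl_singleton_and_continuousAt_iff (hWo.mem_nhds h0)).1
    ⟨?_, hψc.continuousAt (hWo.mem_nhds h0)⟩
  rintro ζ ⟨hζ, hζ0⟩
  refine DifferentiableAt.differentiableWithinAt ?_
  refine differentiableAt_of_comp_eq (q := fun ζ => ζ ^ m + c)
    (hψc.continuousAt (hWo.mem_nhds hζ)) (hd.analyticAt (hG.mem_nhds (hψG hζ))) ?_ (by fun_prop) ?_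
  · refine hder _ (hψG hζ) ?_
    rw [hψ ζ hζ]
    exact fun h => pow_ne_zero m hζ0 (by simpa using h)
  · filter_upwards [hWo.mem_nhds hζ] with x hx using hψ x hx

theorem isCompact_preimage_pow_add {m : ℕ} (hm : m ≠ 0) (c : ℂ) {L : Set ℂ} (hL : IsCompact L) :
    IsCompact {ζ : ℂ | ζ ^ m + c ∈ L} := by
  obtain ⟨M, hM⟩ := hL.isBounded.subset_closedBall c
  refine (isCompact_closedBall (0 : ℂ) (max 1 M)).of_isClosed_subset
    (hL.isClosed.preimage (by fun_prop)) fun ζ hζ => ?_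
  have h1 : ‖ζ‖ ^ m ≤ M := by simpa using hM hζ
  rw [mem_closedBall_zero_iff]
  by_contra hlt
  push Not at hlt
  have h2 : 1 ≤ ‖ζ‖ := (le_max_left _ _).trans hlt.le
  have h3 : ‖ζ‖ ≤ ‖ζ‖ ^ m := le_self_pow₀ h2 hm
  have := le_max_right 1 M
  linarith

/-- The image is open, and closed in the connected set `G`: if `ψ (ζ n)` converges in `G`, then `ζ n
^ m + c` converges in the slit plane, so properness of the power map gives a limit point of `ζ n` in
the root domain. -/
theorem image_root_section {f ψ : ℂ → ℂ} {G : Set ℂ} {J : Set ℝ} {c : ℝ} {m : ℕ}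
    (hm : m ≠ 0) (hJ : IsOpen J) (hJc : J.OrdConnected) (hcJ : c ∈ J)
    (hGc : IsPreconnected G) (hd : ContinuousOn f G) (hmaps : MapsTo f G (slitPlane J))
    (hψd : DifferentiableOn ℂ ψ (rootDomain m J c)) (hψG : MapsTo ψ (rootDomain m J c) G)
    (hψ : ∀ ζ ∈ rootDomain m J c, f (ψ ζ) = ζ ^ m + c) :
    ψ '' rootDomain m J c = G := by
  have hWo := isOpen_rootDomain m hJ c
  have h0 := zero_mem_rootDomain hm hcJ
  have hWc : IsPreconnected (rootDomain m J c) :=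
    ((starConvex_rootDomain hm hJc hcJ).isPathConnected h0).isConnected.isPreconnected
  have hopen : IsOpen (ψ '' rootDomain m J c) := by
    rcases (hψd.analyticOnNhd hWo).is_constant_or_isOpen hWc with ⟨w, hw⟩ | h
    · exfalso
      obtain ⟨r, hr, hrW⟩ := Metric.isOpen_iff.1 hWo 0 h0
      have h1 : ((r / 2 : ℝ) : ℂ) ∈ rootDomain m J c := hrW (by
        rw [mem_ball_zero_iff, Complex.norm_real, Real.norm_of_nonneg (by linarith)]
        linarith)
      have h2 := hψ _ h1
      have h3 := hψ _ h0
      rw [hw _ h1, ← hw _ h0, h3, zero_pow hm] at h2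
      have h4 : ((r / 2 : ℝ) : ℂ) ^ m = 0 := by linear_combination -h2
      have h5 : r / 2 = 0 := by exact_mod_cast (pow_eq_zero_iff hm).1 h4
      linarith
    · exact h _ subset_rfl hWo
  refine subset_antisymm hψG.image_subset ?_
  refine hGc.subset_of_closure_inter_subset hopen ⟨ψ 0, hψG h0, mem_image_of_mem ψ h0⟩ ?_
  rintro z ⟨hz, hzG⟩
  obtain ⟨u, hu, huz⟩ := mem_closure_iff_seq_limit.1 hz
  choose ζ hζ hζu using hu
  have hfu : Tendsto (fun n => f (u n)) atTop (𝓝 (f z)) :=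
    (hd z hzG).tendsto.comp (tendsto_nhdsWithin_iff.2 ⟨huz, Eventually.of_forall fun n => by
      rw [← hζu n]; exact hψG (hζ n)⟩)
  have hcomp := isCompact_preimage_pow_add hm c hfu.isCompact_insert_range
  obtain ⟨ξ, -, φ, hφ, hξ⟩ := hcomp.tendsto_subseq (x := ζ) fun n => by
    refine Or.inr ⟨n, ?_⟩
    simp only
    rw [← hζu n, hψ _ (hζ n)]
  have h1 : ξ ^ m + c = f z := by
    have h2 : Tendsto (fun n => ζ (φ n) ^ m + (c : ℂ)) atTop (𝓝 (ξ ^ m + c)) :=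
      (hξ.pow m).add tendsto_const_nhds
    refine tendsto_nhds_unique h2 ((hfu.comp hφ.tendsto_atTop).congr fun n => ?_)
    simp only [Function.comp_apply]
    rw [← hζu, hψ _ (hζ _)]
  have hξW : ξ ∈ rootDomain m J c := by
    change ξ ^ m + (c : ℂ) ∈ slitPlane J
    rw [h1]
    exact hmaps hzG
  refine ⟨ξ, hξW, ?_⟩
  have h2 : Tendsto (fun n => ψ (ζ (φ n))) atTop (𝓝 (ψ ξ)) :=
    (hψd.continuousOn.continuousAt (hWo.mem_nhds hξW)).tendsto.comp hξ
  refine tendsto_nhds_unique h2 ((huz.comp hφ.tendsto_atTop).congr fun n => ?_)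
  simp [hζu]

/-! ### Uniformization of Epstein maps by the cubic -/

theorem ncard_cube_roots {w : ℂ} (hw : w ≠ 0) : {ζ : ℂ | ζ ^ 3 = w}.ncard = 3 := by
  obtain ⟨a, ha⟩ := IsAlgClosed.exists_pow_nat_eq w (n := 3) (by norm_num)
  have hprim := Complex.isPrimitiveRoot_exp 3 (by norm_num)
  have h1 := hprim.card_nthRoots w
  rw [if_pos ⟨a, ha⟩] at h1
  have h2 := hprim.nthRoots_nodup (a := w) hw
  have h3 : {ζ : ℂ | ζ ^ 3 = w} = ((Polynomial.nthRoots 3 w).toFinset : Set ℂ) := by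
    ext ζ
    simp [Polynomial.mem_nthRoots]
  rw [h3, Set.ncard_coe_finset, Multiset.toFinset_card_of_nodup h2, h1]

theorem finite_cube_roots (w : ℂ) : {ζ : ℂ | ζ ^ 3 = w}.Finite := by
  have h3 : {ζ : ℂ | ζ ^ 3 = w} ⊆ ((Polynomial.nthRoots 3 w).toFinset : Set ℂ) := by
    intro ζ hζ
    simpa [Polynomial.mem_nthRoots] using hζ
  exact (Finset.finite_toSet _).subset h3

theorem finsum_mem_eq_ncard {S : Set ℂ} {u : ℂ → ℕ} (hu : ∀ z ∈ S, u z = 1) :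
    ∑ᶠ z ∈ S, u z = S.ncard := by
  rw [finsum_mem_congr rfl hu]
  exact finsum_one

/-- A three-fold branched covering of a slit plane with one branch point is uniformized by the
cubic map. -/
theorem exists_uniformization {f : ℂ → ℂ} {G : Set ℂ} {J : Set ℝ} {c : ℝ}
    (hJ : IsOpen J) (hJc : J.OrdConnected) (hcJ : c ∈ J) (hG : IsOpen G) (hGc : IsPreconnected G)
    (h0 : (0 : ℂ) ∈ G) (hf0 : f 0 = c) (hcov : IsBranchedCovering 3 f G (slitPlane J))
    (hbr : ∀ z ∈ G, deriv f z = 0 ↔ z = 0) :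
    ∃ ψ : ℂ → ℂ, DifferentiableOn ℂ ψ (rootDomain 3 J c) ∧ InjOn ψ (rootDomain 3 J c) ∧
      ψ '' rootDomain 3 J c = G ∧ ψ 0 = 0 ∧ ∀ ζ ∈ rootDomain 3 J c, f (ψ ζ) = ζ ^ 3 + c := by
  have hd := hcov.analytic
  have hder : ∀ z ∈ G, f z ≠ c → deriv f z ≠ 0 := by
    intro z hz hzc h
    rw [(hbr z hz).1 h] at hzc
    exact hzc hf0
  have ha : AnalyticAt ℂ f 0 := hd.analyticAt (hG.mem_nhds h0)
  have hac : AnalyticAt ℂ (fun z => f z - c) 0 := ha.sub analyticAt_const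
  -- Infinite order would make `f` constant near `0`, hence critical at points other than `0`.
  have hne : analyticOrderAt (fun z => f z - (c : ℂ)) 0 ≠ ⊤ := by
    intro h
    rw [analyticOrderAt_eq_top] at h
    have h1 : ∀ᶠ z in 𝓝[≠] (0 : ℂ), False := by
      have h2 := h.eventually_nhds
      filter_upwards [nhdsWithin_le_nhds h2, nhdsWithin_le_nhds (hG.mem_nhds h0),
        self_mem_nhdsWithin] with z hz hzG hz0
      refine hz0 ((hbr z hzG).1 ?_)
      have h3 : f =ᶠ[𝓝 z] fun _ => (c : ℂ) := by
        filter_upwards [hz] with x hx using sub_eq_zero.1 hx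
      rw [h3.deriv_eq]
      simp
    exact (NeBot.ne inferInstance) (eventually_false_iff_eq_bot.1 h1)
  have hm0 : analyticOrderNatAt (fun z => f z - (c : ℂ)) 0 ≠ 0 := by
    intro h
    have h1 := Nat.cast_analyticOrderNatAt hne
    rw [h] at h1
    exact (hac.analyticOrderAt_eq_zero.1 h1.symm) (by simp [hf0])
  obtain ⟨ε, hε, ψ₀, h1, h2, h3, h4⟩ := exists_local_root (hG.mem_nhds h0) ha hne hm0
  set m := analyticOrderNatAt (fun z => f z - (c : ℂ)) 0 with hm
  obtain ⟨ψ, hψc, hψ0, hψG, hψ⟩ := exists_continuous_root_section hm0 hJ hJc hcJ hG hd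
    hcov.mapsTo hcov.proper hder hε h1 h2 h3 h4
  have hψd := differentiableOn_root_section hm0 hJ hcJ hG hd hder hψc hψG hψ
  have himg := image_root_section hm0 hJ hJc hcJ hGc hd.continuousOn hcov.mapsTo hψd hψG hψ
  -- The local order `m` is not yet known to be three, since `c` could have noncritical preimages as
  -- well. Surjectivity of `ψ` excludes these, so the degree over `c` is exactly `m`.
  have hfib : {z | z ∈ G ∧ f z = c} = {0} := by
    ext z
    constructor
    · rintro ⟨hz, hzc⟩
      rw [← himg] at hz
      obtain ⟨ζ, hζ, rfl⟩ := hz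
      rw [hψ ζ hζ] at hzc
      have h5 : ζ ^ m = 0 := by linear_combination hzc
      rw [mem_singleton_iff, (pow_eq_zero_iff hm0).1 h5, hψ0]
    · rintro rfl
      exact ⟨h0, hf0⟩
  have hm3 : m = 3 := by
    have h5 := hcov.degree c (mem_slitPlane.2 (Or.inr (by simpa using hcJ)))
    rwa [hfib, finsum_mem_singleton] at h5
  rw [hm3] at hψd himg hψG hψ
  refine ⟨ψ, hψd, ?_, himg, hψ0, hψ⟩
  intro ζ hζ ξ hξ hζξ
  have hcube : ζ ^ 3 = ξ ^ 3 := by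
    have := hψ ζ hζ
    rw [hζξ, hψ ξ hξ] at this
    linear_combination -this
  by_cases hζ0 : ζ = 0
  · rw [hζ0, zero_pow (by norm_num)] at hcube
    rw [hζ0, (pow_eq_zero_iff (by norm_num)).1 hcube.symm]
  have hw0 : ζ ^ 3 ≠ 0 := pow_ne_zero 3 hζ0
  have hroots : ∀ x : ℂ, x ^ 3 = ζ ^ 3 → x ∈ rootDomain 3 J c := by
    intro x hx
    change x ^ 3 + (c : ℂ) ∈ slitPlane J
    rw [hx]
    exact hζ
  have hfib' : {z | z ∈ G ∧ f z = ζ ^ 3 + c} = ψ '' {x | x ^ 3 = ζ ^ 3} := by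
    ext z
    constructor
    · rintro ⟨hz, hzc⟩
      rw [← himg] at hz
      obtain ⟨x, hx, rfl⟩ := hz
      rw [hψ x hx] at hzc
      exact ⟨x, by simpa using hzc, rfl⟩
    · rintro ⟨x, hx, rfl⟩
      have hx' := hroots x hx
      refine ⟨hψG hx', ?_⟩
      rw [hψ x hx', show x ^ 3 = ζ ^ 3 from hx]
  -- Over a value other than `c` the fibre has three simple points and is the `ψ`-image of the three
  -- cube roots, so `ψ` is injective on them.
  have hdeg := hcov.degree _ hζ
  rw [finsum_mem_eq_ncard, hfib'] at hdeg
  · refine Set.injOn_of_ncard_image_eq (hdeg.trans (ncard_cube_roots hw0).symm)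
      (finite_cube_roots _) (show ζ ^ 3 = ζ ^ 3 from rfl) hcube.symm hζξ
  · rintro z ⟨hz, hzw⟩
    have hzne : deriv f z ≠ 0 := hder z hz (by
      rw [hzw]
      exact fun h => hw0 (by simpa using h))
    have := (hd.analyticAt (hG.mem_nhds hz)).analyticOrderAt_sub_eq_one_of_deriv_ne_zero hzne
    rw [hzw] at this
    rw [analyticOrderNatAt, this]
    rfl

/-- `ψ` uniformizes `f : G → slitPlane J` by the cubic map `ζ ↦ ζ ^ 3 + c`, and maps `[0, l]`
monotonically onto `[0, 1]`. -/
structure Uniformizes (f : ℂ → ℂ) (G : Set ℂ) (J : Set ℝ) (c l : ℝ) (ψ : ℂ → ℂ) : Prop where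
  diff : DifferentiableOn ℂ ψ (rootDomain 3 J c)
  inj : InjOn ψ (rootDomain 3 J c)
  image_eq : ψ '' rootDomain 3 J c = G
  zero : ψ 0 = 0
  one : ψ l = 1
  eq : ∀ ζ ∈ rootDomain 3 J c, f (ψ ζ) = ζ ^ 3 + c
  im_eq : ∀ t ∈ Icc 0 l, (ψ (t : ℝ)).im = 0
  mono : MonotoneOn (fun t : ℝ => (ψ t).re) (Icc 0 l)

theorem ofReal_mem_rootDomain {J : Set ℝ} {c t : ℝ} (h : t ^ 3 + c ∈ J) :
    (t : ℂ) ∈ rootDomain 3 J c := by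
  refine mem_slitPlane.2 (Or.inr ?_)
  have : ((t : ℂ) ^ 3 + c) = ((t ^ 3 + c : ℝ) : ℂ) := by push_cast; ring
  rw [this, Complex.ofReal_re]
  exact h

theorem IsEpsteinMap.exists_uniformizes {g : ℝ → ℝ} {J : Set ℝ} {G : Set ℂ} {f : ℂ → ℂ}
    (h : IsEpsteinMap 1 g J G f) {l : ℝ} (hl : 0 < l) (hl3 : l ^ 3 = g 1 - g 0) :
    ∃ ψ, Uniformizes f G J (g 0) l ψ := by
  have hI : uIcc (0 : ℝ) 1 = Icc 0 1 := uIcc_of_le zero_le_one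
  have hmono := h.strictMono
  have hgc := h.continuousOn
  have hsub := h.image_subset
  have hGI := h.subset_dom
  have hext := h.extends_map
  rw [hI] at hmono hgc hsub hGI hext
  have m0 : (0 : ℝ) ∈ Icc (0 : ℝ) 1 := by simp
  have m1 : (1 : ℝ) ∈ Icc (0 : ℝ) 1 := by simp
  set c := g 0 with hc
  have hcJ : c ∈ J := hsub ⟨0, m0, rfl⟩
  obtain ⟨ψ₁, hd, hinj, himg, h0, heq⟩ := exists_uniformization h.isOpen_range h.interval_range hcJ
    h.isOpen_dom h.simplyConnected_dom.isPathConnected.isConnected.isPreconnected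
    (by simpa using hGI 0 m0) (by simpa using hext 0 m0) h.covering h.branch
  set W := rootDomain 3 J c with hW
  have hWo : IsOpen W := isOpen_rootDomain 3 h.isOpen_range c
  obtain ⟨ζ₁, hζ₁, hζ₁1⟩ : (1 : ℂ) ∈ ψ₁ '' W := by
    rw [himg]; simpa using hGI 1 m1
  have hl0 : (l : ℂ) ≠ 0 := by exact_mod_cast hl.ne'
  have hζ₁3 : ζ₁ ^ 3 = (l : ℂ) ^ 3 := by
    have h1 := heq ζ₁ hζ₁
    have h2 : f 1 = g 1 := by simpa using hext 1 m1
    have h3 : ((l ^ 3 : ℝ) : ℂ) = ((g 1 - c : ℝ) : ℂ) := by rw [hl3]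
    push_cast at h3
    rw [hζ₁1, h2] at h1
    rw [h3]
    linear_combination -h1
  -- The uniformization is only determined up to rotation by a cube root of unity; this one moves
  -- the preimage of `1` to the positive number `l`.
  set ω := ζ₁ / l with hω
  have hω3 : ω ^ 3 = 1 := by rw [hω, div_pow, hζ₁3, div_self (pow_ne_zero 3 hl0)]
  have hω0 : ω ≠ 0 := by
    intro h
    rw [h] at hω3
    norm_num at hω3
  have hωW : ∀ ζ, ω * ζ ∈ W ↔ ζ ∈ W := by
    intro ζ
    change (ω * ζ) ^ 3 + (c : ℂ) ∈ slitPlane J ↔ ζ ^ 3 + (c : ℂ) ∈ slitPlane J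
    rw [mul_pow, hω3, one_mul]
  let ψ : ℂ → ℂ := fun ζ => ψ₁ (ω * ζ)
  have hψd : DifferentiableOn ℂ ψ W :=
    hd.comp (by fun_prop) fun ζ hζ => (hωW ζ).2 hζ
  have hψinj : InjOn ψ W := fun x hx y hy hxy =>
    mul_left_cancel₀ hω0 (hinj ((hωW x).2 hx) ((hωW y).2 hy) hxy)
  have hψimg : ψ '' W = G := by
    rw [← himg]
    ext z
    constructor
    · rintro ⟨ζ, hζ, rfl⟩
      exact ⟨_, (hωW ζ).2 hζ, rfl⟩
    · rintro ⟨ζ, hζ, rfl⟩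
      have h1 : ω * (ω⁻¹ * ζ) = ζ := mul_inv_cancel_left₀ hω0 ζ
      refine ⟨ω⁻¹ * ζ, (hωW _).1 (by rwa [h1]), ?_⟩
      simp only [ψ, h1]
  have hψ0 : ψ 0 = 0 := by simp [ψ, h0]
  have hψ1 : ψ l = 1 := by
    simp only [ψ, hω]
    rw [div_mul_cancel₀ _ hl0, hζ₁1]
  have hψeq : ∀ ζ ∈ W, f (ψ ζ) = ζ ^ 3 + c := by
    intro ζ hζ
    rw [heq _ ((hωW ζ).2 hζ), mul_pow, hω3, one_mul]
  let P := Function.invFunOn ψ W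
  have hP : ∀ x ∈ W, P (ψ x) = x := fun x hx => hψinj.leftInvOn_invFunOn hx
  have hPc : ContinuousOn P G := by
    rw [← hψimg]
    exact continuousOn_inverse hWo hψd hψinj hP
  have hP' : ∀ z ∈ G, P z ∈ W ∧ ψ (P z) = z := by
    intro z hz
    rw [← hψimg] at hz
    obtain ⟨x, hx, rfl⟩ := hz
    rw [hP x hx]
    exact ⟨hx, rfl⟩
  let r : ℝ → ℝ := fun x => (g x - c) ^ ((3 : ℕ) : ℝ)⁻¹
  have hgc0 : ∀ x ∈ Icc (0 : ℝ) 1, 0 ≤ g x - c := fun x hx =>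
    sub_nonneg.2 (hmono.monotoneOn m0 hx hx.1)
  have hr3 : ∀ x ∈ Icc (0 : ℝ) 1, r x ^ 3 = g x - c := fun x hx =>
    Real.rpow_inv_natCast_pow (hgc0 x hx) (by norm_num)
  have hr0 : ∀ x ∈ Icc (0 : ℝ) 1, 0 ≤ r x := fun x hx => Real.rpow_nonneg (hgc0 x hx) _
  have hrpos : ∀ x ∈ Ioc (0 : ℝ) 1, 0 < r x := fun x hx =>
    Real.rpow_pos_of_pos (sub_pos.2 (hmono m0 ⟨hx.1.le, hx.2⟩ hx.1)) _
  have hrc : ContinuousOn r (Icc 0 1) :=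
    (hgc.sub continuousOn_const).rpow_const fun x _ => Or.inr (by positivity)
  have hr1 : r 1 = l := by
    simp only [r]
    rw [← hl3]
    exact Real.pow_rpow_inv_natCast hl.le (by norm_num)
  have hr00 : r 0 = 0 := by
    simp only [r]
    rw [← hc, sub_self]
    exact Real.zero_rpow (by norm_num)
  have hPr3 : ∀ x ∈ Icc (0 : ℝ) 1, P x ^ 3 = (r x : ℂ) ^ 3 := by
    intro x hx
    have h1 := hψeq _ (hP' x (hGI x hx)).1
    rw [(hP' x (hGI x hx)).2, hext x hx] at h1
    have h2 : ((r x ^ 3 : ℝ) : ℂ) = ((g x - c : ℝ) : ℂ) := by rw [hr3 x hx]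
    push_cast at h2
    rw [h2]
    linear_combination -h1
  have hPr : ∀ x ∈ Icc (0 : ℝ) 1, P x = r x := by
    intro x hx
    rcases hx.1.eq_or_lt with hx0 | hx0
    · have h1 := hPr3 x hx
      have h2 : r x = 0 := by rw [← hx0, hr00]
      rw [h2] at h1 ⊢
      simpa using h1
    -- `P x` and the real root `r x` have the same cube, so their quotient is a continuous map from
    -- `(0, 1]` to the cube roots of unity. It is constant, and equals `1` at `x = 1` by the choice
    -- of `ω`.
    let u : ℝ → ℂ := fun x => P x / r x
    have huc : ContinuousOn u (Ioc 0 1) := by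
      have hs : Ioc (0 : ℝ) 1 ⊆ Icc 0 1 := Ioc_subset_Icc_self
      refine ContinuousOn.div ?_ ?_ fun x hx => by exact_mod_cast (hrpos x hx).ne'
      · exact hPc.comp Complex.continuous_ofReal.continuousOn fun x hx => hGI x (hs hx)
      · exact Complex.continuous_ofReal.comp_continuousOn (hrc.mono hs)
    have humaps : MapsTo u (Ioc 0 1) {ζ : ℂ | ζ ^ 3 = 1} := by
      intro y hy
      have h1 : (r y : ℂ) ≠ 0 := by exact_mod_cast (hrpos y hy).ne'
      simp only [u, Set.mem_ofPred_eq]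
      rw [div_pow, hPr3 y ⟨hy.1.le, hy.2⟩, div_self (pow_ne_zero 3 h1)]
    have h1 := isPreconnected_Ioc.constant_of_mapsTo (finite_cube_roots 1).isDiscrete huc humaps
      (show x ∈ Ioc (0 : ℝ) 1 from ⟨hx0, hx.2⟩) (show (1 : ℝ) ∈ Ioc (0 : ℝ) 1 by simp)
    have h2 : u 1 = 1 := by
      have h3 : (l : ℂ) ∈ W := ofReal_mem_rootDomain (by
        rw [hl3]; simpa using hsub ⟨1, m1, rfl⟩)
      have h4 := hP _ h3
      rw [hψ1] at h4
      simp only [u, hr1, Complex.ofReal_one]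
      rw [h4, div_self hl0]
    rw [h2] at h1
    have h3 : (r x : ℂ) ≠ 0 := by exact_mod_cast (hrpos x ⟨hx0, hx.2⟩).ne'
    exact (div_eq_one_iff_eq h3).1 h1
  have hψr : ∀ x ∈ Icc (0 : ℝ) 1, ψ (r x) = x := by
    intro x hx
    rw [← hPr x hx]
    exact (hP' x (hGI x hx)).2
  have hkey : ∀ t ∈ Icc 0 l, ∃ x ∈ Icc (0 : ℝ) 1, r x = t ∧ ψ t = x := by
    intro t ht
    have h1 : t ∈ Icc (r 0) (r 1) := by
      rwa [hr1, hr00]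
    obtain ⟨x, hx, hxt⟩ := intermediate_value_Icc zero_le_one hrc h1
    exact ⟨x, hx, hxt, by rw [← hxt]; exact hψr x hx⟩
  refine ⟨ψ, hψd, hψinj, hψimg, hψ0, hψ1, hψeq, ?_, ?_⟩
  · intro t ht
    obtain ⟨x, -, -, hx⟩ := hkey t ht
    simp [hx]
  · intro t ht t' ht' htt'
    obtain ⟨x, hx, hxt, hx'⟩ := hkey t ht
    obtain ⟨y, hy, hyt, hy'⟩ := hkey t' ht'
    simp only [hx', hy', Complex.ofReal_re]
    refine (hmono.le_iff_le hx hy).1 ?_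
    have h1 : r x ^ 3 ≤ r y ^ 3 := by
      have := hr0 x hx
      gcongr
      rw [hxt, hyt]; exact htt'
    rw [hr3 x hx, hr3 y hy] at h1
    linarith

/-! ### The metric bounds in terms of the endpoints of `J` -/

theorem setDist_Icc {c d : ℝ} (hcd : c ≤ d) :
    setDist (Icc 0 1) (Icc c d) = max 0 (max (c - 1) (-d)) := by
  refine IsLeast.csInf_eq ⟨?_, ?_⟩
  · rcases le_or_gt c 1 with hc | hc
    · rcases le_or_gt 0 d with hd | hd
      · refine ⟨max c 0, ⟨le_max_right _ _, max_le hc zero_le_one⟩, max c 0,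
          ⟨le_max_left _ _, max_le hcd hd⟩, ?_⟩
        rw [dist_self, max_eq_left]
        exact max_le (by linarith) (by linarith)
      · refine ⟨0, by simp, d, ⟨hcd, le_rfl⟩, ?_⟩
        rw [Real.dist_eq, abs_of_nonneg (by linarith), max_eq_right, max_eq_right]
        · ring
        · linarith
        · exact le_max_of_le_right (by linarith)
    · refine ⟨1, by simp, c, ⟨le_rfl, hcd⟩, ?_⟩
      rw [Real.dist_eq, abs_of_nonpos (by linarith), max_eq_right, max_eq_left]
      · ring
      · linarith
      · exact le_max_of_le_left (by linarith)
  · rintro _ ⟨x, hx, y, hy, rfl⟩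
    rw [Real.dist_eq]
    refine max_le (abs_nonneg _) (max_le ?_ ?_)
    · linarith [neg_abs_le (x - y), hx.2, hy.1]
    · linarith [le_abs_self (x - y), hx.1, hy.2]

/-- If `y` outside `J` were at distance less than `e` from `[c, d]`, the component of `J \ [c, d]`
next to `[c, d]` on that side would lie between `y` and `[c, d]` and be too short. Such a component
exists because `J` is open. -/
theorem Ioo_subset_of_space {J : Set ℝ} (hJ : IsOpen J) (hJc : J.OrdConnected) {c d e : ℝ}
    (hcd : c ≤ d) (hsub : Icc c d ⊆ J)
    (h : ∀ x ∈ J \ Icc c d,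
      ENNReal.ofReal e ≤ volume (connectedComponentIn (J \ Icc c d) x)) :
    Ioo (c - e) (d + e) ⊆ J := by
  have hcJ : c ∈ J := hsub ⟨le_rfl, hcd⟩
  have hdJ : d ∈ J := hsub ⟨hcd, le_rfl⟩
  intro y hy
  by_contra hyJ
  have hycd : y ∉ Icc c d := fun h => hyJ (hsub h)
  have hcomp : ∀ x ∈ J \ Icc c d,
      (connectedComponentIn (J \ Icc c d) x).OrdConnected ∧
      x ∈ connectedComponentIn (J \ Icc c d) x ∧
      connectedComponentIn (J \ Icc c d) x ⊆ J \ Icc c d := fun x hx =>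
    ⟨isPreconnected_connectedComponentIn.ordConnected, mem_connectedComponentIn hx,
      connectedComponentIn_subset _ _⟩
  rcases lt_or_ge d y with hdy | hyd
  · obtain ⟨x, hx, hdx⟩ : ∃ x ∈ J, d < x := by
      obtain ⟨r, hr, hrJ⟩ := Metric.isOpen_iff.1 hJ d hdJ
      exact ⟨d + r / 2, hrJ (by simp [abs_of_pos hr]; linarith), by linarith⟩
    have hxm : x ∈ J \ Icc c d := ⟨hx, fun h => by linarith [h.2]⟩
    obtain ⟨h1, h2, h3⟩ := hcomp x hxm
    have h4 : connectedComponentIn (J \ Icc c d) x ⊆ Ioo d y := by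
      intro z hz
      have hdz : d < z := by
        by_contra hle
        push Not at hle
        exact (h3 (h1.out hz h2 ⟨hle, hdx.le⟩)).2 ⟨hcd, le_rfl⟩
      refine ⟨hdz, ?_⟩
      by_contra hle
      push Not at hle
      exact hyJ (hJc.out hdJ (h3 hz).1 ⟨hdy.le, hle⟩)
    have h5 := (h x hxm).trans (measure_mono h4)
    rw [Real.volume_Ioo, ENNReal.ofReal_le_ofReal_iff (by linarith)] at h5
    linarith [hy.2]
  · have hyc : y < c := by
      by_contra hle
      push Not at hle
      exact hycd ⟨hle, hyd⟩
    obtain ⟨x, hx, hxc⟩ : ∃ x ∈ J, x < c := by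
      obtain ⟨r, hr, hrJ⟩ := Metric.isOpen_iff.1 hJ c hcJ
      exact ⟨c - r / 2, hrJ (by simp [abs_of_pos hr]; linarith), by linarith⟩
    have hxm : x ∈ J \ Icc c d := ⟨hx, fun h => by linarith [h.1]⟩
    obtain ⟨h1, h2, h3⟩ := hcomp x hxm
    have h4 : connectedComponentIn (J \ Icc c d) x ⊆ Ioo y c := by
      intro z hz
      have hdz : z < c := by
        by_contra hle
        push Not at hle
        exact (h3 (h1.out h2 hz ⟨hxc.le, hle⟩)).2 ⟨le_rfl, hcd⟩
      refine ⟨?_, hdz⟩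
      by_contra hle
      push Not at hle
      exact hyJ (hJc.out (h3 hz).1 hcJ ⟨hle, hyc.le⟩)
    have h5 := (h x hxm).trans (measure_mono h4)
    rw [Real.volume_Ioo, ENNReal.ofReal_le_ofReal_iff (by linarith)] at h5
    linarith [hy.1]

theorem space_of_Ioo_subset {J : Set ℝ} (hJc : J.OrdConnected) {c d e : ℝ}
    (hcd : c ≤ d) (h : Ioo (c - e) (d + e) ⊆ J) {x : ℝ} (hx : x ∈ J \ Icc c d) :
    ENNReal.ofReal e ≤ volume (connectedComponentIn (J \ Icc c d) x) := by
  rcases le_or_gt e 0 with he | he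
  · rw [ENNReal.ofReal_of_nonpos he]
    exact zero_le
  rcases lt_or_ge d x with hdx | hxd
  · have h1 : IsPreconnected (J ∩ Ioi d) := (hJc.inter ordConnected_Ioi).isPreconnected
    have h2 : J ∩ Ioi d ⊆ J \ Icc c d := fun z hz => ⟨hz.1, fun h => not_lt.2 h.2 hz.2⟩
    have h3 := h1.subset_connectedComponentIn (show x ∈ J ∩ Ioi d from ⟨hx.1, hdx⟩) h2
    have h4 : Ioo d (d + e) ⊆ J ∩ Ioi d := fun z hz => ⟨h ⟨by linarith [hz.1], hz.2⟩, hz.1⟩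
    have h5 := measure_mono (μ := volume) (h4.trans h3)
    rw [Real.volume_Ioo] at h5
    simpa using h5
  · have hxc : x < c := by
      by_contra hle
      push Not at hle
      exact hx.2 ⟨hle, hxd⟩
    have h1 : IsPreconnected (J ∩ Iio c) := (hJc.inter ordConnected_Iio).isPreconnected
    have h2 : J ∩ Iio c ⊆ J \ Icc c d := fun z hz => ⟨hz.1, fun h => not_lt.2 h.1 hz.2⟩
    have h3 := h1.subset_connectedComponentIn (show x ∈ J ∩ Iio c from ⟨hx.1, hxc⟩) h2
    have h4 : Ioo (c - e) c ⊆ J ∩ Iio c := fun z hz => ⟨h ⟨hz.1, by linarith [hz.2]⟩, hz.2⟩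
    have h5 := measure_mono (μ := volume) (h4.trans h3)
    rw [Real.volume_Ioo] at h5
    simpa using h5

/-- In this form the bounds are weak inequalities between continuous functions of `c` and `d` and an
inclusion of open intervals, all of which survive limits. -/
theorem hasBounds_iff {s c d : ℝ} {g : ℝ → ℝ} {J : Set ℝ} (hJ : IsOpen J) (hJc : J.OrdConnected)
    (hcd : c < d) (hg : g '' uIcc 0 1 = Icc c d) (hsub : Icc c d ⊆ J) :
    HasBounds s 1 g J ↔ (s ≤ 1 / (d - c) ∧ 1 / (d - c) ≤ s⁻¹) ∧
      (s ≤ max 0 (max (c - 1) (-d)) / (d - c) ∧ max 0 (max (c - 1) (-d)) / (d - c) ≤ s⁻¹) ∧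
      Ioo (c - s * (d - c)) (d + s * (d - c)) ⊆ J := by
  have hI : uIcc (0 : ℝ) 1 = Icc 0 1 := uIcc_of_le zero_le_one
  have h1 : Metric.diam (Icc c d) = d - c := Real.diam_Icc hcd.le
  have h2 : Metric.diam (Icc (0 : ℝ) 1) = 1 := by rw [Real.diam_Icc zero_le_one, sub_zero]
  have h3 := setDist_Icc hcd.le
  have h4 : |d - c| = d - c := abs_of_pos (sub_pos.2 hcd)
  have h5 : |max 0 (max (c - 1) (-d))| = max 0 (max (c - 1) (-d)) :=
    abs_of_nonneg (le_max_left _ _)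
  constructor
  · rintro ⟨h6, h7, h8⟩
    rw [hg, hI] at h6 h7
    rw [hg, h1] at h8
    rw [Commensurable, h1, h2, h4, abs_one, inv_inv] at h6
    rw [Commensurable, h1, h3, h4, h5, inv_inv] at h7
    exact ⟨h6, h7, Ioo_subset_of_space hJ hJc hcd.le hsub h8⟩
  · rintro ⟨h6, h7, h8⟩
    refine ⟨?_, ?_, ?_⟩
    · rw [hg, hI, Commensurable, h1, h2, h4, abs_one, inv_inv]
      exact h6
    · rw [hg, hI, Commensurable, h1, h3, h4, h5, inv_inv]
      exact h7
    · rw [hg, h1]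
      exact fun x hx => space_of_Ioo_subset hJc hcd.le h8 hx

/-! ### From a normalized univalent map to an Epstein map -/

theorem isSimplyConnected_image_of_injOn {ψ : ℂ → ℂ} {W : Set ℂ} (hW : IsOpen W)
    (hd : DifferentiableOn ℂ ψ W) (hinj : InjOn ψ W) (hstar : StarConvex ℝ 0 W)
    (h0 : (0 : ℂ) ∈ W) : IsSimplyConnected (ψ '' W) := by
  have hemb : IsOpenEmbedding (W.domRestrict ψ) := by
    refine IsOpenEmbedding.of_continuous_injective_isOpenMap hd.continuousOn.domRestrict
      (injOn_iff_injective.1 hinj) fun V hV => ?_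
    have h1 := isOpen_image_of_injOn hW hd hinj (hW.isOpenMap_subtype_val V hV)
      (Subtype.coe_image_subset W V)
    rw [image_image] at h1
    exact h1
  have : ContractibleSpace W := hstar.contractibleSpace ⟨0, h0⟩
  have h1 : SimplyConnectedSpace W := inferInstance
  have h2 : SimplyConnectedSpace (range (W.domRestrict ψ)) :=
    hemb.isEmbedding.toHomeomorph.toHomotopyEquiv.simplyConnectedSpace_iff.1 h1
  rwa [range_domRestrict] at h2

/-- The converse of uniformization. -/
theorem exists_isEpsteinMap {J : Set ℝ} {c l : ℝ} (hJ : IsOpen J) (hJc : J.OrdConnected)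
    (hl : 0 < l) (hsub : Icc c (l ^ 3 + c) ⊆ J) {ψ : ℂ → ℂ}
    (hd : DifferentiableOn ℂ ψ (rootDomain 3 J c)) (hinj : InjOn ψ (rootDomain 3 J c))
    (h0 : ψ 0 = 0) (h1 : ψ l = 1) (him : ∀ t ∈ Icc 0 l, (ψ (t : ℝ)).im = 0)
    (hmono : MonotoneOn (fun t : ℝ => (ψ t).re) (Icc 0 l))
    {P : ℂ → ℂ} (hP : ∀ ζ ∈ rootDomain 3 J c, P (ψ ζ) = ζ) :
    IsEpsteinMap 1 (fun x : ℝ => (P x ^ 3 + c).re) J (ψ '' rootDomain 3 J c)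
      (fun z => P z ^ 3 + c) ∧ P 0 = 0 ∧ P 1 = l := by
  have hcl : c ≤ l ^ 3 + c := by have := pow_pos hl 3; linarith
  have hcJ : c ∈ J := hsub ⟨le_rfl, hcl⟩
  set W := rootDomain 3 J c with hW
  have hWo : IsOpen W := isOpen_rootDomain 3 hJ c
  have hW0 : (0 : ℂ) ∈ W := zero_mem_rootDomain (by norm_num) hcJ
  have htJ : ∀ t ∈ Icc 0 l, t ^ 3 + c ∈ J := fun t ht => hsub
    ⟨by have := pow_nonneg ht.1 3; linarith,
      by have := pow_le_pow_left₀ ht.1 ht.2 3; linarith⟩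
  have htW : ∀ t ∈ Icc 0 l, (t : ℂ) ∈ W := fun t ht => ofReal_mem_rootDomain (htJ t ht)
  have hGo : IsOpen (ψ '' W) := isOpen_image_of_injOn hWo hd hinj hWo subset_rfl
  have hPd : DifferentiableOn ℂ P (ψ '' W) := differentiableOn_inverse hWo hd hinj hP
  have hP0 : P 0 = 0 := by simpa [h0] using hP 0 hW0
  have hP1 : P 1 = l := by rw [← h1, hP _ (htW l ⟨hl.le, le_rfl⟩)]
  have hre : ∀ t ∈ Icc 0 l, ψ (t : ℝ) = ((ψ t).re : ℂ) := fun t ht =>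
    Complex.ext (by simp) (by simp [him t ht])
  have hcont : ContinuousOn (fun t : ℝ => (ψ t).re) (Icc 0 l) :=
    Complex.continuous_re.comp_continuousOn
      (hd.continuousOn.comp Complex.continuous_ofReal.continuousOn fun t ht => htW t ht)
  have hsurj : ∀ x ∈ Icc (0 : ℝ) 1, ∃ t ∈ Icc 0 l, ψ (t : ℝ) = x := by
    intro x hx
    have h2 : x ∈ Icc (ψ ((0 : ℝ) : ℂ)).re (ψ (l : ℂ)).re := by
      simpa [h0, h1] using hx
    obtain ⟨t, ht, htx⟩ := intermediate_value_Icc hl.le hcont h2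
    refine ⟨t, ht, ?_⟩
    rw [hre t ht]
    exact_mod_cast htx
  have hPx : ∀ x ∈ Icc (0 : ℝ) 1, ∃ t ∈ Icc 0 l, ψ (t : ℝ) = x ∧ P x = t ∧
      P x ^ 3 + c = ((t ^ 3 + c : ℝ) : ℂ) := by
    intro x hx
    obtain ⟨t, ht, htx⟩ := hsurj x hx
    have : P x = t := by rw [← htx, hP _ (htW t ht)]
    refine ⟨t, ht, htx, this, ?_⟩
    rw [this]; push_cast; ring
  have hI : uIcc (0 : ℝ) 1 = Icc 0 1 := uIcc_of_le zero_le_one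
  have hfd : DifferentiableOn ℂ (fun z => P z ^ 3 + (c : ℂ)) (ψ '' W) :=
    (hPd.pow 3).add_const _
  have hIG : ∀ x ∈ Icc (0 : ℝ) 1, (x : ℂ) ∈ ψ '' W := by
    intro x hx
    obtain ⟨t, ht, htx⟩ := hsurj x hx
    exact ⟨t, htW t ht, htx⟩
  -- As `P` has no critical points, `P ^ 3 + c` is critical only where `P` vanishes, that is, at
  -- `0`. The order there is three, which is the degree over `c`; other fibres are three simple
  -- points.
  have hPder : ∀ z ∈ ψ '' W, deriv P z ≠ 0 := by
    rintro _ ⟨ζ, hζ, rfl⟩ h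
    have := deriv_mul_deriv_inverse hWo hd hinj hP hζ
    rw [h, zero_mul] at this
    exact zero_ne_one this
  have hP0' : ∀ z ∈ ψ '' W, P z = 0 ↔ z = 0 := by
    rintro _ ⟨ζ, hζ, rfl⟩
    rw [hP ζ hζ]
    constructor
    · rintro rfl
      exact h0
    · intro h
      exact hinj hζ hW0 (h.trans h0.symm)
  have hfder : ∀ z ∈ ψ '' W, deriv (fun z => P z ^ 3 + (c : ℂ)) z = 3 * P z ^ 2 * deriv P z := by
    intro z hz
    have h2 := (((hPd.differentiableAt (hGo.mem_nhds hz)).hasDerivAt.pow 3).add_const (c : ℂ)).deriv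
    simpa using h2
  have hbranch : ∀ z ∈ ψ '' W, deriv (fun z => P z ^ 3 + (c : ℂ)) z = 0 ↔ z = 0 := by
    intro z hz
    rw [hfder z hz, ← hP0' z hz]
    simp [hPder z hz]
  have hz0 : (0 : ℂ) ∈ ψ '' W := ⟨0, hW0, h0⟩
  refine ⟨⟨one_ne_zero, ?_, ?_, hJ, hJc, ?_, hGo, ?_, ?_, ?_, ⟨hfd, ?_, ?_, ?_⟩, hbranch⟩, hP0, hP1⟩
  · rw [hI]
    intro x hx y hy hxy
    obtain ⟨t, ht, htx, -, hx'⟩ := hPx x hx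
    obtain ⟨t', ht', hty, -, hy'⟩ := hPx y hy
    simp only [hx', hy', Complex.ofReal_re]
    have htt : t < t' := by
      by_contra hle
      push Not at hle
      have := hmono ht' ht hle
      simp only [htx, hty, Complex.ofReal_re] at this
      linarith
    have := pow_lt_pow_left₀ htt ht.1 (n := 3) (by norm_num)
    linarith
  · rw [hI]
    exact Complex.continuous_re.comp_continuousOn
      (hfd.continuousOn.comp Complex.continuous_ofReal.continuousOn fun x hx => hIG x hx)
  · rw [hI]
    rintro _ ⟨x, hx, rfl⟩
    obtain ⟨t, ht, -, -, hx'⟩ := hPx x hx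
    simp only [hx', Complex.ofReal_re]
    exact htJ t ht
  · exact isSimplyConnected_image_of_injOn hWo hd hinj
      (starConvex_rootDomain (by norm_num) hJc hcJ) hW0
  · rw [hI]
    exact hIG
  · rw [hI]
    intro x hx
    obtain ⟨t, ht, -, -, hx'⟩ := hPx x hx
    simp only [hx', Complex.ofReal_re]
  · rintro _ ⟨ζ, hζ, rfl⟩
    simp only [hP ζ hζ]
    exact hζ
  · intro L hL hLc
    have h2 : ψ '' W ∩ (fun z => P z ^ 3 + (c : ℂ)) ⁻¹' L = ψ '' {ζ | ζ ^ 3 + (c : ℂ) ∈ L} := by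
      ext z
      constructor
      · rintro ⟨⟨ζ, hζ, rfl⟩, hz⟩
        rw [mem_preimage, hP ζ hζ] at hz
        exact ⟨ζ, hz, rfl⟩
      · rintro ⟨ζ, hζ, rfl⟩
        have hζW : ζ ∈ W := hL hζ
        refine ⟨⟨ζ, hζW, rfl⟩, ?_⟩
        rw [mem_preimage, hP ζ hζW]
        exact hζ
    rw [h2]
    exact (isCompact_preimage_pow_add (by norm_num) (c : ℂ) hLc).image_of_continuousOn
      (hd.continuousOn.mono fun ζ hζ => hL hζ)
  · intro w hw
    by_cases hwc : w = c
    · subst hwc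
      have h2 : {z | z ∈ ψ '' W ∧ P z ^ 3 + (c : ℂ) = c} = {0} := by
        ext z
        constructor
        · rintro ⟨hz, hzc⟩
          have h3 : P z ^ 3 = 0 := by simpa using hzc
          exact (hP0' z hz).1 ((pow_eq_zero_iff (by norm_num)).1 h3)
        · rintro rfl
          exact ⟨hz0, by simp [hP0]⟩
      have hPa : AnalyticAt ℂ P 0 := hPd.analyticAt (hGo.mem_nhds hz0)
      have h3 : (fun x => P x ^ 3 + (c : ℂ) - c) = P ^ 3 := by
        funext x
        simp
      rw [h2, finsum_mem_singleton, h3, analyticOrderNatAt_pow hPa, analyticOrderNatAt,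
        hPa.analyticOrderAt_eq_one_of_zero_deriv_ne_zero hP0 (hPder 0 hz0)]
      rfl
    · have hw0 : w - c ≠ 0 := sub_ne_zero.2 hwc
      have hroot : ∀ ζ : ℂ, ζ ^ 3 = w - c → ζ ∈ W := by
        intro ζ hζ
        change ζ ^ 3 + (c : ℂ) ∈ slitPlane J
        rw [hζ, sub_add_cancel]
        exact hw
      have h2 : {z | z ∈ ψ '' W ∧ P z ^ 3 + (c : ℂ) = w} = ψ '' {ζ | ζ ^ 3 = w - c} := by
        ext z
        constructor
        · rintro ⟨⟨ζ, hζ, rfl⟩, hz⟩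
          rw [hP ζ hζ] at hz
          exact ⟨ζ, eq_sub_of_add_eq hz, rfl⟩
        · rintro ⟨ζ, hζ, rfl⟩
          have hζW := hroot ζ hζ
          refine ⟨⟨ζ, hζW, rfl⟩, ?_⟩
          rw [hP ζ hζW, show ζ ^ 3 = w - c from hζ, sub_add_cancel]
      rw [finsum_mem_eq_ncard, h2, Set.InjOn.ncard_image, ncard_cube_roots hw0]
      · exact hinj.mono fun ζ hζ => hroot ζ hζ
      · rintro z ⟨hz, hzw⟩
        have h3 : deriv (fun z => P z ^ 3 + (c : ℂ)) z ≠ 0 := by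
          rw [Ne, hbranch z hz]
          rintro rfl
          refine hwc ?_
          rw [← hzw, hP0]
          simp
        have h4 := (hfd.analyticAt (hGo.mem_nhds hz)).analyticOrderAt_sub_eq_one_of_deriv_ne_zero h3
        simp only [hzw] at h4
        rw [analyticOrderNatAt, h4]
        rfl

/-! ### Intervals with extended real endpoints, and convergence of root domains -/

/-- The reals strictly between two extended reals. -/
def realIoo (α β : EReal) : Set ℝ := {x | α < x ∧ x < β}

theorem isOpen_realIoo (α β : EReal) : IsOpen (realIoo α β) :=
  (isOpen_Ioo (a := α) (b := β)).preimage continuous_coe_real_ereal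

theorem ordConnected_realIoo (α β : EReal) : (realIoo α β).OrdConnected :=
  ⟨fun _ hx _ hy _ hz => ⟨hx.1.trans_le (EReal.coe_le_coe_iff.2 hz.1),
    (EReal.coe_le_coe_iff.2 hz.2).trans_lt hy.2⟩⟩

/-- Extended endpoints treat bounded and unbounded intervals alike, and `EReal` is compact, so the
endpoints of any sequence of intervals subconverge. -/
theorem exists_eq_realIoo {J : Set ℝ} (hJ : IsOpen J) (hJc : J.OrdConnected) :
    ∃ α β : EReal, J = realIoo α β := by
  refine ⟨sInf ((↑) '' J), sSup ((↑) '' J), ?_⟩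
  ext x
  constructor
  · intro hx
    obtain ⟨r, hr, hrJ⟩ := Metric.isOpen_iff.1 hJ x hx
    have h1 : x - r / 2 ∈ J := hrJ (by simp [abs_of_pos hr]; linarith)
    have h2 : x + r / 2 ∈ J := hrJ (by simp [abs_of_pos hr]; linarith)
    exact ⟨(sInf_le (mem_image_of_mem _ h1)).trans_lt (EReal.coe_lt_coe_iff.2 (by linarith)),
      (EReal.coe_lt_coe_iff.2 (by linarith)).trans_le (le_sSup (mem_image_of_mem _ h2))⟩
  · rintro ⟨h1, h2⟩
    obtain ⟨_, ⟨y, hy, rfl⟩, hyx⟩ := sInf_lt_iff.1 h1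
    obtain ⟨_, ⟨z, hz, rfl⟩, hxz⟩ := lt_sSup_iff.1 h2
    exact hJc.out hy hz ⟨(EReal.coe_lt_coe_iff.1 hyx).le, (EReal.coe_lt_coe_iff.1 hxz).le⟩

section Kernel

variable {α β : ℕ → EReal} {c : ℕ → ℝ} {α' β' : EReal} {c' : ℝ}

theorem eventually_mem_rootDomain (hα : Tendsto α atTop (𝓝 α')) (hβ : Tendsto β atTop (𝓝 β'))
    (hc : Tendsto c atTop (𝓝 c')) {ζ : ℂ} (hζ : ζ ∈ rootDomain 3 (realIoo α' β') c') :
    ∃ r > 0, ∀ᶠ n in atTop, ball ζ r ⊆ rootDomain 3 (realIoo (α n) (β n)) (c n) := by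
  have hw : Tendsto (fun p : ℕ × ℂ => p.2 ^ 3 + (c p.1 : ℂ)) (atTop ×ˢ 𝓝 ζ) (𝓝 (ζ ^ 3 + c')) :=
    (tendsto_snd.pow 3).add ((Complex.continuous_ofReal.tendsto c').comp (hc.comp tendsto_fst))
  have hev : ∀ᶠ p : ℕ × ℂ in atTop ×ˢ 𝓝 ζ,
      p.2 ∈ rootDomain 3 (realIoo (α p.1) (β p.1)) (c p.1) := by
    rcases mem_slitPlane.1 hζ with him | hre
    · have h1 := (Complex.continuous_im.tendsto _).comp hw
      filter_upwards [h1.eventually_ne him] with p hp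
      exact mem_slitPlane.2 (Or.inl hp)
    · have h1 : Tendsto (fun p : ℕ × ℂ => (((p.2 ^ 3 + (c p.1 : ℂ)).re : ℝ) : EReal))
          (atTop ×ˢ 𝓝 ζ) (𝓝 ((ζ ^ 3 + (c' : ℂ)).re : ℝ)) :=
        (continuous_coe_real_ereal.tendsto _).comp ((Complex.continuous_re.tendsto _).comp hw)
      filter_upwards [(hα.comp tendsto_fst).eventually_lt h1 hre.1,
        h1.eventually_lt (hβ.comp tendsto_fst) hre.2] with p hp hp'
      exact mem_slitPlane.2 (Or.inr ⟨hp, hp'⟩)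
  obtain ⟨A, hA, B, hB, hAB⟩ := eventually_prod_iff.1 hev
  obtain ⟨r, hr, hr'⟩ := Metric.eventually_nhds_iff_ball.1 hB
  exact ⟨r, hr, hA.mono fun n hn x hx => hAB hn (hr' x hx)⟩

/-- If `ζ` were outside the limit domain, `ζ ^ 3` would be real with `ζ ^ 3 + c'` at or beyond an
endpoint. Moving `ζ` outward by a factor `t > 1` within the ball carries this value strictly past
the endpoint, hence out of the approximating intervals for large `n`. -/
theorem mem_rootDomain_of_ball_subset (hα : Tendsto α atTop (𝓝 α')) (hβ : Tendsto β atTop (𝓝 β'))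
    (hc : Tendsto c atTop (𝓝 c')) (hc' : c' ∈ realIoo α' β') {ζ : ℂ} {r : ℝ} (hr : 0 < r)
    (h : ∀ᶠ n in atTop, ball ζ r ⊆ rootDomain 3 (realIoo (α n) (β n)) (c n)) :
    ζ ∈ rootDomain 3 (realIoo α' β') c' := by
  by_contra hζ
  have hζ' : ¬ ((ζ ^ 3 + (c' : ℂ)).im ≠ 0 ∨ (ζ ^ 3 + (c' : ℂ)).re ∈ realIoo α' β') :=
    fun h => hζ (mem_slitPlane.2 h)
  push Not at hζ'
  obtain ⟨him, hre⟩ := hζ'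
  simp only [Complex.add_im, Complex.ofReal_im, add_zero, Complex.add_re,
    Complex.ofReal_re] at him hre
  set y := (ζ ^ 3).re with hy
  obtain ⟨t, ht1, ht⟩ : ∃ t : ℝ, 1 < t ∧ (t : ℂ) * ζ ∈ ball ζ r := by
    refine ⟨1 + r / (2 * (‖ζ‖ + 1)), by have := norm_nonneg ζ; simp; positivity, ?_⟩
    rw [mem_ball, dist_eq_norm]
    have h1 : ((1 + r / (2 * (‖ζ‖ + 1)) : ℝ) : ℂ) * ζ - ζ = ((r / (2 * (‖ζ‖ + 1)) : ℝ) : ℂ) * ζ := by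
      push_cast; ring
    have h0 := norm_nonneg ζ
    rw [h1, norm_mul, Complex.norm_real, Real.norm_of_nonneg (by positivity),
      div_mul_eq_mul_div, div_lt_iff₀ (by positivity)]
    nlinarith
  have ht3 : 1 < t ^ 3 := one_lt_pow₀ ht1 (by norm_num)
  have hcub : ∀ n, (((t : ℂ) * ζ) ^ 3 + (c n : ℂ)).im = 0 ∧
      (((t : ℂ) * ζ) ^ 3 + (c n : ℂ)).re = t ^ 3 * y + c n := by
    intro n
    have h1 : ((t : ℂ) * ζ) ^ 3 = ((t ^ 3 : ℝ) : ℂ) * ζ ^ 3 := by push_cast; ring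
    rw [h1]
    simp [-Complex.ofReal_pow, him, hy]
  have hlim : Tendsto (fun n => ((t ^ 3 * y + c n : ℝ) : EReal)) atTop
      (𝓝 ((t ^ 3 * y + c' : ℝ) : EReal)) :=
    (continuous_coe_real_ereal.tendsto _).comp (tendsto_const_nhds.add hc)
  have hmem : ∀ᶠ n in atTop, t ^ 3 * y + c n ∈ realIoo (α n) (β n) := by
    filter_upwards [h] with n hn
    rcases mem_slitPlane.1 (hn ht) with h1 | h1
    · exact absurd (hcub n).1 h1
    · rwa [(hcub n).2] at h1
  by_cases hα1 : α' < ((y + c' : ℝ) : EReal)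
  · have hβ1 : β' ≤ ((y + c' : ℝ) : EReal) := not_lt.1 fun h => hre ⟨hα1, h⟩
    have hy0 : 0 < y := by
      have := EReal.coe_lt_coe_iff.1 (hc'.2.trans_le hβ1)
      linarith
    have h1 : β' < ((t ^ 3 * y + c' : ℝ) : EReal) :=
      hβ1.trans_lt (EReal.coe_lt_coe_iff.2 (by nlinarith))
    obtain ⟨n, h2, h3⟩ := ((hβ.eventually_lt hlim h1).and hmem).exists
    exact lt_asymm h2 h3.2
  · have hα2 := not_lt.1 hα1
    have hy0 : y < 0 := by
      have := EReal.coe_lt_coe_iff.1 (hα2.trans_lt hc'.1)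
      linarith
    have h1 : ((t ^ 3 * y + c' : ℝ) : EReal) < α' :=
      (EReal.coe_lt_coe_iff.2 (by nlinarith)).trans_le hα2
    obtain ⟨n, h2, h3⟩ := ((hlim.eventually_lt hα h1).and hmem).exists
    exact lt_asymm h2 h3.1

end Kernel

/-! ### Normality of the uniformizing maps -/

/-- A sequence of uniformized maps whose parameters converge. -/
structure ConvData (f : ℕ → ℂ → ℂ) (G : ℕ → Set ℂ) (α β : ℕ → EReal) (c l : ℕ → ℝ)
    (ψ : ℕ → ℂ → ℂ) (α' β' : EReal) (c' l' : ℝ) : Prop where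
  unif : ∀ n, Uniformizes (f n) (G n) (realIoo (α n) (β n)) (c n) (l n) (ψ n)
  pos : ∀ n, 0 < l n
  sub : ∀ n, Icc (c n) (l n ^ 3 + c n) ⊆ realIoo (α n) (β n)
  tα : Tendsto α atTop (𝓝 α')
  tβ : Tendsto β atTop (𝓝 β')
  tc : Tendsto c atTop (𝓝 c')
  tl : Tendsto l atTop (𝓝 l')
  pos' : 0 < l'
  sub' : Icc c' (l' ^ 3 + c') ⊆ realIoo α' β'

namespace ConvData

variable {f : ℕ → ℂ → ℂ} {G : ℕ → Set ℂ} {α β : ℕ → EReal} {c l : ℕ → ℝ}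
    {ψ : ℕ → ℂ → ℂ} {α' β' : EReal} {c' l' : ℝ}

theorem subseq (h : ConvData f G α β c l ψ α' β' c' l') {φ : ℕ → ℕ} (hφ : StrictMono φ) :
    ConvData (fun n => f (φ n)) (fun n => G (φ n)) (fun n => α (φ n)) (fun n => β (φ n))
      (fun n => c (φ n)) (fun n => l (φ n)) (fun n => ψ (φ n)) α' β' c' l' :=
  ⟨fun _ => h.unif _, fun _ => h.pos _, fun _ => h.sub _, h.tα.comp hφ.tendsto_atTop,
    h.tβ.comp hφ.tendsto_atTop, h.tc.comp hφ.tendsto_atTop, h.tl.comp hφ.tendsto_atTop,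
    h.pos', h.sub'⟩

theorem center_mem (h : ConvData f G α β c l ψ α' β' c' l') : c' ∈ realIoo α' β' :=
  h.sub' ⟨le_rfl, by have := pow_pos h.pos' 3; linarith⟩

theorem center_mem_seq (h : ConvData f G α β c l ψ α' β' c' l') (n : ℕ) :
    c n ∈ realIoo (α n) (β n) :=
  h.sub n ⟨le_rfl, by have := pow_pos (h.pos n) 3; linarith⟩

theorem ofReal_mem (h : ConvData f G α β c l ψ α' β' c' l') {t : ℝ} (ht : t ∈ Icc 0 l') :
    (t : ℂ) ∈ rootDomain 3 (realIoo α' β') c' :=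
  ofReal_mem_rootDomain (h.sub' ⟨by have := pow_nonneg ht.1 3; linarith,
      by have := pow_le_pow_left₀ ht.1 ht.2 3; linarith⟩)

theorem end_mem_seq (h : ConvData f G α β c l ψ α' β' c' l') (n : ℕ) :
    (l n : ℂ) ∈ rootDomain 3 (realIoo (α n) (β n)) (c n) :=
  ofReal_mem_rootDomain (h.sub n ⟨by have := pow_pos (h.pos n) 3; linarith, le_rfl⟩)

theorem exists_ball_subset (h : ConvData f G α β c l ψ α' β' c' l') {ζ : ℂ}
    (hζ : ζ ∈ rootDomain 3 (realIoo α' β') c') :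
    ∃ r > 0, ∀ᶠ n in atTop, ball ζ r ⊆ rootDomain 3 (realIoo (α n) (β n)) (c n) :=
  eventually_mem_rootDomain h.tα h.tβ h.tc hζ

theorem evInjAt (h : ConvData f G α β c l ψ α' β' c' l') {ζ : ℂ}
    (hζ : ζ ∈ rootDomain 3 (realIoo α' β') c') : EvInjAt ψ ζ := by
  obtain ⟨r, hr, hr'⟩ := h.exists_ball_subset hζ
  exact ⟨r, hr, hr'.mono fun n hn => ⟨(h.unif n).diff.mono hn, (h.unif n).inj.mono hn⟩⟩

theorem isPreconnected_limit (h : ConvData f G α β c l ψ α' β' c' l') :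
    IsPreconnected (rootDomain 3 (realIoo α' β') c') :=
  ((starConvex_rootDomain (by norm_num) (ordConnected_realIoo _ _) h.center_mem).isPathConnected
    (zero_mem_rootDomain (by norm_num) h.center_mem)).isConnected.isPreconnected

theorem zero_mem_limit (h : ConvData f G α β c l ψ α' β' c' l') :
    (0 : ℂ) ∈ rootDomain 3 (realIoo α' β') c' :=
  zero_mem_rootDomain (by norm_num) h.center_mem

theorem zero_mem_seq (h : ConvData f G α β c l ψ α' β' c' l') (n : ℕ) :
    (0 : ℂ) ∈ rootDomain 3 (realIoo (α n) (β n)) (c n) :=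
  zero_mem_rootDomain (by norm_num) (h.center_mem_seq n)

/-- `ψ n` takes the value `1` only at `l n > l' / 2`, so it omits `1` on a fixed disc about `0`. The
Harnack inequality applies with `‖ψ n 0 - 1‖ = 1`. -/
theorem evBddAt_zero (h : ConvData f G α β c l ψ α' β' c' l') : EvBddAt ψ 0 := by
  obtain ⟨r, hr, hr'⟩ := h.exists_ball_subset h.zero_mem_limit
  have hρ : 0 < min r (l' / 2) := lt_min hr (half_pos h.pos')
  refine ⟨min r (l' / 2) / 2, half_pos hρ, Real.exp 384 + 1, ?_⟩
  filter_upwards [hr', h.tl.eventually (lt_mem_nhds (half_lt_self h.pos'))] with n hn hln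
  have hsub : ball (0 : ℂ) (min r (l' / 2)) ⊆ rootDomain 3 (realIoo (α n) (β n)) (c n) :=
    (ball_subset_ball (min_le_left _ _)).trans hn
  have hd := (h.unif n).diff.mono hsub
  have hi := (h.unif n).inj.mono hsub
  refine ⟨hd.mono (ball_subset_ball (by linarith)), fun x hx => ?_⟩
  have h1 := norm_sub_le_of_injOn_of_omits hd hi (v := 1) (fun z hz hz1 => ?_) hx
  · rw [(h.unif n).zero, zero_sub, norm_neg, norm_one, mul_one] at h1
    calc ‖ψ n x‖ = ‖(ψ n x - 1) + 1‖ := by rw [sub_add_cancel]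
      _ ≤ ‖ψ n x - 1‖ + ‖(1 : ℂ)‖ := norm_add_le _ _
      _ ≤ _ := by rw [norm_one]; linarith
  · have h2 := (h.unif n).inj (hsub hz) (h.end_mem_seq n) (hz1.trans (h.unif n).one.symm)
    rw [h2, mem_ball_zero_iff, Complex.norm_real, Real.norm_of_nonneg (h.pos n).le] at hz
    have := hz.trans_le (min_le_right _ _)
    linarith

/-- The points near which the sequence is bounded form an open set containing `0`. It is relatively
closed in the connected limit domain: on a disc avoiding the origin `ψ n` omits `0`, so the Harnack
inequality carries a bound from one point to its neighbours. -/
theorem evBddAt (h : ConvData f G α β c l ψ α' β' c' l') {ζ : ℂ}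
    (hζ : ζ ∈ rootDomain 3 (realIoo α' β') c') : EvBddAt ψ ζ := by
  let S : Set ℂ := {ζ | EvBddAt ψ ζ}
  have hSo : IsOpen S := by
    rw [Metric.isOpen_iff]
    rintro x ⟨r, hr, M, hM⟩
    refine ⟨r / 2, half_pos hr, fun y hy => ⟨r / 2, half_pos hr, M, ?_⟩⟩
    have hsub : ball y (r / 2) ⊆ ball x r :=
      ball_subset_ball' (by have := mem_ball.1 hy; linarith)
    exact hM.mono fun n hn => ⟨hn.1.mono hsub, fun z hz => hn.2 z (hsub hz)⟩
  refine h.isPreconnected_limit.subset_of_closure_inter_subset hSo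
    ⟨0, h.zero_mem_limit, h.evBddAt_zero⟩ ?_ hζ
  rintro x ⟨hxS, hxW⟩
  by_cases hx0 : x = 0
  · rw [hx0]
    exact h.evBddAt_zero
  obtain ⟨r₀, hr₀, hr'⟩ := h.exists_ball_subset hxW
  set r := min r₀ ‖x‖ with hrdef
  have hr : 0 < r := lt_min hr₀ (norm_pos_iff.2 hx0)
  -- With `y` within `r / 8` of `x`, the disc of radius `3 * r / 4` about `y` lies in the disc of
  -- radius `r` about `x`, and its half-size copy contains the disc of radius `r / 4` about `x`.
  obtain ⟨y, ⟨ρ, hρ, M, hM⟩, hyx⟩ := Metric.mem_closure_iff.1 hxS (r / 8) (by linarith)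
  refine ⟨r / 4, by linarith, Real.exp 384 * M, ?_⟩
  filter_upwards [hr', hM] with n hn hMn
  have hsub : ball y (3 * r / 4) ⊆ ball x r := ball_subset_ball' (by rw [dist_comm]; linarith)
  have hsub' : ball x r ⊆ rootDomain 3 (realIoo (α n) (β n)) (c n) :=
    (ball_subset_ball (min_le_left _ _)).trans hn
  have hd := (h.unif n).diff.mono (hsub.trans hsub')
  have hi := (h.unif n).inj.mono (hsub.trans hsub')
  refine ⟨((h.unif n).diff.mono hsub').mono (ball_subset_ball (by linarith)), fun z hz => ?_⟩
  have hz' : z ∈ ball y (3 * r / 4 / 2) := by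
    rw [mem_ball] at hz ⊢
    have := dist_triangle z x y
    linarith
  have h1 := norm_sub_le_of_injOn_of_omits hd hi (v := 0) (fun w hw hw0 => ?_) hz'
  · rw [sub_zero, sub_zero] at h1
    exact h1.trans (by gcongr; exact hMn.2 y (mem_ball_self hρ))
  · have h2 := (h.unif n).inj (hsub' (hsub hw)) (h.zero_mem_seq n) (hw0.trans (h.unif n).zero.symm)
    have h3 := mem_ball.1 (hsub hw)
    rw [h2, dist_zero_left] at h3
    exact absurd h3 (not_lt.2 (min_le_right _ _))

end ConvData

/-! ### Properties of the limit of the uniformizing maps -/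

theorem eventually_subset_of_forall_ball {L : Set ℂ} (hL : IsCompact L) {G : ℕ → Set ℂ}
    (h : ∀ z ∈ L, ∃ r > 0, ∀ᶠ n in atTop, ball z r ⊆ G n) : ∀ᶠ n in atTop, L ⊆ G n := by
  refine hL.induction_on (p := fun s => ∀ᶠ n in atTop, s ⊆ G n) ?_ ?_ ?_ ?_
  · exact Eventually.of_forall fun n => empty_subset _
  · exact fun s t hst ht => ht.mono fun n hn => hst.trans hn
  · exact fun s t hs ht => (hs.and ht).mono fun n hn => union_subset hn.1 hn.2
  · intro z hz
    obtain ⟨r, hr, hrG⟩ := h z hz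
    exact ⟨ball z r, mem_nhdsWithin_of_mem_nhds (ball_mem_nhds z hr), hrG⟩

/-- A holomorphic function on a connected open set that takes two values is nowhere locally
constant. -/
theorem eventually_ne_of_differentiableOn {Ψ : ℂ → ℂ} {U : Set ℂ} (hU : IsOpen U)
    (hUc : IsPreconnected U) (hd : DifferentiableOn ℂ Ψ U) {x y : ℂ} (hx : x ∈ U) (hy : y ∈ U)
    (hxy : Ψ x ≠ Ψ y) {z : ℂ} (hz : z ∈ U) : ∀ᶠ w in 𝓝[≠] z, Ψ w ≠ Ψ z := by
  have ha := hd.analyticOnNhd hU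
  refine ((ha z hz).eventually_eq_or_eventually_ne analyticAt_const).resolve_left fun hev => ?_
  have h1 := ha.eqOn_of_preconnected_of_eventuallyEq (g := fun _ => Ψ z)
    (fun _ _ => analyticAt_const) hUc hz hev
  exact hxy ((h1 hx).trans (h1 hy).symm)

namespace ConvData

variable {f : ℕ → ℂ → ℂ} {G : ℕ → Set ℂ} {α β : ℕ → EReal} {c l : ℕ → ℝ}
    {ψ : ℕ → ℂ → ℂ} {α' β' : EReal} {c' l' : ℝ} {Ψ : ℂ → ℂ}

theorem differentiableOn_limit (h : ConvData f G α β c l ψ α' β' c' l')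
    (hΨ : ∀ ζ ∈ rootDomain 3 (realIoo α' β') c', ContConvAt ψ Ψ ζ) :
    DifferentiableOn ℂ Ψ (rootDomain 3 (realIoo α' β') c') :=
  differentiableOn_of_contConvAt (isOpen_rootDomain 3 (isOpen_realIoo _ _) _) hΨ
    fun _ hζ => (h.evInjAt hζ).evDiffAt

theorem limit_zero (h : ConvData f G α β c l ψ α' β' c' l')
    (hΨ : ∀ ζ ∈ rootDomain 3 (realIoo α' β') c', ContConvAt ψ Ψ ζ) : Ψ 0 = 0 := by
  refine tendsto_nhds_unique ((hΨ 0 h.zero_mem_limit).tendsto tendsto_const_nhds) ?_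
  simp only [(h.unif _).zero, tendsto_const_nhds]

theorem limit_one (h : ConvData f G α β c l ψ α' β' c' l')
    (hΨ : ∀ ζ ∈ rootDomain 3 (realIoo α' β') c', ContConvAt ψ Ψ ζ) : Ψ l' = 1 := by
  refine tendsto_nhds_unique ((hΨ l' (h.ofReal_mem ⟨h.pos'.le, le_rfl⟩)).tendsto
    ((Complex.continuous_ofReal.tendsto l').comp h.tl)) ?_
  simp only [Function.comp_apply, (h.unif _).one, tendsto_const_nhds]

theorem injOn_limit (h : ConvData f G α β c l ψ α' β' c' l')
    (hΨ : ∀ ζ ∈ rootDomain 3 (realIoo α' β') c', ContConvAt ψ Ψ ζ) :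
    InjOn Ψ (rootDomain 3 (realIoo α' β') c') := by
  have hWo := isOpen_rootDomain 3 (isOpen_realIoo α' β') c'
  refine injOn_of_contConvAt hWo hΨ (fun K hK hKc => ?_) (fun z hz => h.evInjAt hz) fun z hz => ?_
  · exact (eventually_subset_of_forall_ball hKc fun z hz => h.exists_ball_subset (hK hz)).mono
      fun n hn => (h.unif n).inj.mono hn
  · refine eventually_ne_of_differentiableOn hWo h.isPreconnected_limit
      (h.differentiableOn_limit hΨ) h.zero_mem_limit (h.ofReal_mem ⟨h.pos'.le, le_rfl⟩) ?_ hz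
    rw [h.limit_zero hΨ, h.limit_one hΨ]
    exact zero_ne_one

/-- A fixed `t` may fall outside `[0, l n]`, where nothing is known about reality or monotonicity of
`ψ n`; the rescaled points stay inside and converge to `t`. -/
theorem tendsto_of_mem_Icc (h : ConvData f G α β c l ψ α' β' c' l')
    (hΨ : ∀ ζ ∈ rootDomain 3 (realIoo α' β') c', ContConvAt ψ Ψ ζ) {t : ℝ} (ht : t ∈ Icc 0 l') :
    Tendsto (fun n => ψ n ((t / l' * l n : ℝ) : ℂ)) atTop (𝓝 (Ψ t)) := by
  refine (hΨ t (h.ofReal_mem ht)).tendsto ((Complex.continuous_ofReal.tendsto t).comp ?_)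
  have := h.tl.const_mul (t / l')
  rwa [div_mul_cancel₀ _ h.pos'.ne'] at this

theorem scaled_mem_Icc (h : ConvData f G α β c l ψ α' β' c' l') {t : ℝ} (ht : t ∈ Icc 0 l')
    (n : ℕ) : t / l' * l n ∈ Icc 0 (l n) :=
  ⟨mul_nonneg (div_nonneg ht.1 h.pos'.le) (h.pos n).le,
    mul_le_of_le_one_left (h.pos n).le (div_le_one_of_le₀ ht.2 h.pos'.le)⟩

theorem im_limit (h : ConvData f G α β c l ψ α' β' c' l')
    (hΨ : ∀ ζ ∈ rootDomain 3 (realIoo α' β') c', ContConvAt ψ Ψ ζ) {t : ℝ} (ht : t ∈ Icc 0 l') :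
    (Ψ (t : ℝ)).im = 0 := by
  refine tendsto_nhds_unique
    ((Complex.continuous_im.tendsto _).comp (h.tendsto_of_mem_Icc hΨ ht)) ?_
  refine tendsto_const_nhds.congr fun n => ?_
  exact ((h.unif n).im_eq _ (h.scaled_mem_Icc ht n)).symm

theorem mono_limit (h : ConvData f G α β c l ψ α' β' c' l')
    (hΨ : ∀ ζ ∈ rootDomain 3 (realIoo α' β') c', ContConvAt ψ Ψ ζ) :
    MonotoneOn (fun t : ℝ => (Ψ t).re) (Icc 0 l') := by
  intro t ht t' ht' htt'
  refine le_of_tendsto_of_tendsto'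
    ((Complex.continuous_re.tendsto _).comp (h.tendsto_of_mem_Icc hΨ ht))
    ((Complex.continuous_re.tendsto _).comp (h.tendsto_of_mem_Icc hΨ ht')) fun n => ?_
  refine (h.unif n).mono (h.scaled_mem_Icc ht n) (h.scaled_mem_Icc ht' n) ?_
  have := h.pos n
  have := h.pos'
  gcongr

theorem invFunOn_apply (h : ConvData f G α β c l ψ α' β' c' l') (n : ℕ) {z : ℂ} (hz : z ∈ G n) :
    Function.invFunOn (ψ n) (rootDomain 3 (realIoo (α n) (β n)) (c n)) z ∈
        rootDomain 3 (realIoo (α n) (β n)) (c n) ∧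
      ψ n (Function.invFunOn (ψ n) (rootDomain 3 (realIoo (α n) (β n)) (c n)) z) = z := by
  rw [← (h.unif n).image_eq] at hz
  exact ⟨Function.invFunOn_mem hz, Function.invFunOn_eq hz⟩

theorem eventually_ne_limit (h : ConvData f G α β c l ψ α' β' c' l')
    (hΨ : ∀ ζ ∈ rootDomain 3 (realIoo α' β') c', ContConvAt ψ Ψ ζ) {ζ : ℂ}
    (hζ : ζ ∈ rootDomain 3 (realIoo α' β') c') : ∀ᶠ x in 𝓝[≠] ζ, Ψ x ≠ Ψ ζ :=
  eventually_ne_of_injOn (isOpen_rootDomain 3 (isOpen_realIoo _ _) _) (h.injOn_limit hΨ) hζ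

theorem exists_ball_subset_dom (h : ConvData f G α β c l ψ α' β' c' l')
    (hΨ : ∀ ζ ∈ rootDomain 3 (realIoo α' β') c', ContConvAt ψ Ψ ζ) {z : ℂ}
    (hz : z ∈ Ψ '' rootDomain 3 (realIoo α' β') c') :
    ∃ r > 0, ∀ᶠ n in atTop, ball z r ⊆ G n := by
  obtain ⟨ζ, hζ, rfl⟩ := hz
  obtain ⟨r, hr, hr'⟩ := h.exists_ball_subset hζ
  obtain ⟨ε, hε, hε'⟩ := exists_ball_subset_image_closedBall
    (isOpen_rootDomain 3 (isOpen_realIoo _ _) _) hΨ hζ (h.evInjAt hζ) (h.eventually_ne_limit hΨ hζ)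
    (half_pos hr)
  refine ⟨ε, hε, ?_⟩
  filter_upwards [hr', hε'] with n hn hn'
  rw [← (h.unif n).image_eq]
  exact hn'.trans (image_mono ((closedBall_subset_ball (half_lt_self hr)).trans hn))

theorem contConvAt_inverse (h : ConvData f G α β c l ψ α' β' c' l')
    (hΨ : ∀ ζ ∈ rootDomain 3 (realIoo α' β') c', ContConvAt ψ Ψ ζ) {P : ℂ → ℂ}
    (hP : ∀ ζ ∈ rootDomain 3 (realIoo α' β') c', P (Ψ ζ) = ζ) {z : ℂ}
    (hz : z ∈ Ψ '' rootDomain 3 (realIoo α' β') c') :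
    ContConvAt (fun n => Function.invFunOn (ψ n) (rootDomain 3 (realIoo (α n) (β n)) (c n)))
      P z := by
  obtain ⟨ζ, hζ, rfl⟩ := hz
  rw [ContConvAt, hP ζ hζ]
  refine tendsto_inverse_of_contConvAt
    (P := fun n => Function.invFunOn (ψ n) (rootDomain 3 (realIoo (α n) (β n)) (c n))) (isOpen_rootDomain 3 (isOpen_realIoo _ _) _) hΨ hζ
    (h.evInjAt hζ) (h.eventually_ne_limit hΨ hζ) ?_
  obtain ⟨r, hr, hr'⟩ := h.exists_ball_subset hζ
  exact ⟨r, hr, hr'.mono fun n hn x hx => (h.unif n).inj.leftInvOn_invFunOn (hn hx)⟩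

/-- On its domain `f n` is the cube of the inverse of `ψ n` plus `c n`, so its convergence follows
from that of the inverses. -/
theorem contConvAt_map (h : ConvData f G α β c l ψ α' β' c' l')
    (hΨ : ∀ ζ ∈ rootDomain 3 (realIoo α' β') c', ContConvAt ψ Ψ ζ) {P : ℂ → ℂ}
    (hP : ∀ ζ ∈ rootDomain 3 (realIoo α' β') c', P (Ψ ζ) = ζ) {z : ℂ}
    (hz : z ∈ Ψ '' rootDomain 3 (realIoo α' β') c') :
    ContConvAt f (fun z => P z ^ 3 + c') z := by
  have h1 : Tendsto (fun p : ℕ × ℂ =>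
      Function.invFunOn (ψ p.1) (rootDomain 3 (realIoo (α p.1) (β p.1)) (c p.1)) p.2 ^ 3 +
        (c p.1 : ℂ)) (atTop ×ˢ 𝓝 z) (𝓝 (P z ^ 3 + c')) :=
    ((h.contConvAt_inverse hΨ hP hz).pow 3).add
      ((Complex.continuous_ofReal.tendsto c').comp (h.tc.comp tendsto_fst))
  refine h1.congr' ?_
  obtain ⟨r, hr, hr'⟩ := h.exists_ball_subset_dom hΨ hz
  filter_upwards [hr'.prod_mk (ball_mem_nhds z hr)] with p hp
  obtain ⟨h2, h3⟩ := h.invFunOn_apply p.1 (hp.1 hp.2)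
  rw [← (h.unif p.1).eq _ h2, h3]

/-! ### Carathéodory convergence of the domains -/

/-- A boundary point of the limit domain cannot have a neighbourhood contained in the domains of
the sequence. -/
theorem mem_image_limit_of_mem_closure (h : ConvData f G α β c l ψ α' β' c' l')
    (hΨ : ∀ ζ ∈ rootDomain 3 (realIoo α' β') c', ContConvAt ψ Ψ ζ) {z : ℂ}
    (hz : z ∈ closure (Ψ '' rootDomain 3 (realIoo α' β') c')) {r : ℝ} (hr : 0 < r)
    (hr' : ∀ᶠ n in atTop, ball z r ⊆ G n) : z ∈ Ψ '' rootDomain 3 (realIoo α' β') c' := by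
  by_cases hz0 : z = 0
  · exact ⟨0, h.zero_mem_limit, by rw [hz0, h.limit_zero hΨ]⟩
  -- The ball then misses `0`, so the inverses `Q n` omit the value `0` on it and the Harnack
  -- inequality applies to them.
  wlog hrz : r ≤ ‖z‖ generalizing r
  · exact this (r := min r ‖z‖) (lt_min hr (norm_pos_iff.2 hz0))
      (hr'.mono fun n hn => (ball_subset_ball (min_le_left _ _)).trans hn) (min_le_right _ _)
  set W := rootDomain 3 (realIoo α' β') c' with hW
  have hWo : IsOpen W := isOpen_rootDomain 3 (isOpen_realIoo _ _) _
  set P := Function.invFunOn Ψ W with hPdef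
  have hP : ∀ ζ ∈ W, P (Ψ ζ) = ζ := fun ζ hζ => (h.injOn_limit hΨ).leftInvOn_invFunOn hζ
  set Q : ℕ → ℂ → ℂ :=
    fun n => Function.invFunOn (ψ n) (rootDomain 3 (realIoo (α n) (β n)) (c n)) with hQdef
  have hGo : IsOpen (Ψ '' W) :=
    isOpen_image_of_injOn hWo (h.differentiableOn_limit hΨ) (h.injOn_limit hΨ) hWo subset_rfl
  have hQG : ∀ n, DifferentiableOn ℂ (Q n) (G n) ∧ InjOn (Q n) (G n) := by
    intro n
    constructor
    · rw [← (h.unif n).image_eq]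
      exact differentiableOn_inverse (isOpen_rootDomain 3 (isOpen_realIoo _ _) _) (h.unif n).diff
        (h.unif n).inj fun x hx => (h.unif n).inj.leftInvOn_invFunOn hx
    · intro x hx y hy hxy
      rw [← (h.invFunOn_apply n hx).2, ← (h.invFunOn_apply n hy).2]
      exact congrArg (ψ n) hxy
  obtain ⟨b, hb, hbz⟩ := Metric.mem_closure_iff.1 hz (r / 4) (by linarith)
  have hbz' : dist b z < r / 4 := by rwa [dist_comm]
  have hsub : ball b (3 * r / 4) ⊆ ball z r := ball_subset_ball' (by linarith)
  set B := ball b (3 * r / 4 / 2) with hB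
  have hBz : B ⊆ ball z r := (ball_subset_ball (by linarith)).trans hsub
  have hzB : z ∈ B := by rw [hB, mem_ball]; linarith
  have hbB : b ∈ B := mem_ball_self (by linarith)
  have hQb : Tendsto (fun n => Q n b) atTop (𝓝 (P b)) :=
    (h.contConvAt_inverse hΨ hP hb).tendsto tendsto_const_nhds
  have hbdd : ∀ x ∈ B, EvBddAt Q x := by
    intro x hx
    obtain ⟨ρ, hρ, hρB⟩ := Metric.isOpen_iff.1 (isOpen_ball : IsOpen B) x hx
    refine ⟨ρ, hρ, Real.exp 384 * (‖P b‖ + 1), ?_⟩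
    filter_upwards [hr', hQb.norm.eventually (gt_mem_nhds (lt_add_one ‖P b‖))] with n hn hnb
    refine ⟨(hQG n).1.mono (hρB.trans (hBz.trans hn)), fun y hy => ?_⟩
    have h1 := norm_sub_le_of_injOn_of_omits ((hQG n).1.mono (hsub.trans hn))
      ((hQG n).2.mono (hsub.trans hn)) (v := 0) (fun w hw hw0 => ?_) (hρB hy)
    · rw [sub_zero, sub_zero] at h1
      exact h1.trans (by gcongr)
    · have h2 := (h.invFunOn_apply n (hn (hsub hw))).2
      change ψ n (Q n w) = w at h2
      rw [hw0, (h.unif n).zero] at h2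
      have h3 := mem_ball.1 (hsub hw)
      rw [← h2, dist_zero_left] at h3
      linarith
  obtain ⟨φ, hφ, R, hR⟩ := exists_subseq_contConvAt isOpen_ball hbdd
  have hQinj : ∀ x ∈ B, EvInjAt (fun n => Q (φ n)) x := by
    intro x hx
    obtain ⟨ρ, hρ, hρB⟩ := Metric.isOpen_iff.1 (isOpen_ball : IsOpen B) x hx
    refine ⟨ρ, hρ, (hφ.tendsto_atTop.eventually hr').mono fun n hn => ?_⟩
    exact ⟨(hQG _).1.mono (hρB.trans (hBz.trans hn)), (hQG _).2.mono (hρB.trans (hBz.trans hn))⟩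
  have hRd : DifferentiableOn ℂ R B :=
    differentiableOn_of_contConvAt isOpen_ball hR fun x hx => (hQinj x hx).evDiffAt
  have hRP : ∀ x ∈ B ∩ Ψ '' W, R x = P x := by
    rintro x ⟨hx, hx'⟩
    exact tendsto_nhds_unique ((hR x hx).tendsto tendsto_const_nhds)
      (((h.contConvAt_inverse hΨ hP hx').tendsto tendsto_const_nhds).comp hφ.tendsto_atTop)
  -- On the part of `B` inside the image of `Ψ`, the limit `R` is the injective inverse `P`, so it
  -- takes two values and is nowhere locally constant on `B`.
  have hRne : ∀ᶠ x in 𝓝[≠] z, R x ≠ R z := by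
    obtain ⟨δ, hδ, hδ'⟩ := Metric.isOpen_iff.1 ((isOpen_ball : IsOpen B).inter hGo) b ⟨hbB, hb⟩
    have hb' : b + (δ / 2 : ℝ) ∈ B ∩ Ψ '' W := hδ' (by simp [abs_of_pos hδ]; linarith)
    refine eventually_ne_of_differentiableOn isOpen_ball (convex_ball _ _).isPreconnected hRd hbB
      hb'.1 (fun heq => ?_) hzB
    rw [hRP b ⟨hbB, hb⟩, hRP _ hb'] at heq
    obtain ⟨x, hx, hxb⟩ := hb
    obtain ⟨y, hy, hyb⟩ := hb'.2
    rw [← hxb, hP x hx, hxb, ← hyb, hP y hy] at heq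
    rw [heq, hyb] at hxb
    have : (δ : ℂ) = 0 := by simpa using hxb
    exact hδ.ne' (by exact_mod_cast this)
  obtain ⟨ε, hε, hε'⟩ := exists_ball_subset_image_closedBall isOpen_ball hR hzB (hQinj z hzB) hRne
    (half_pos hr)
  -- By the stable open mapping theorem the sets `Q n '' closedBall z (r / 2)`, which lie in the
  -- approximating root domains, contain a fixed disc about `R z` for large `n` along the
  -- subsequence.
  have hRW : R z ∈ W := by
    refine mem_rootDomain_of_ball_subset (h.subseq hφ).tα (h.subseq hφ).tβ (h.subseq hφ).tc
      h.center_mem hε ?_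
    filter_upwards [hε', hφ.tendsto_atTop.eventually hr'] with n hn hn'
    refine hn.trans ?_
    rintro _ ⟨x, hx, rfl⟩
    exact (h.invFunOn_apply _ (hn' (closedBall_subset_ball (half_lt_self hr) hx))).1
  refine ⟨R z, hRW, ?_⟩
  have h1 := ((hΨ _ hRW).comp_strictMono hφ).tendsto ((hR z hzB).tendsto tendsto_const_nhds)
  refine tendsto_nhds_unique h1 (tendsto_const_nhds.congr' ?_)
  filter_upwards [hφ.tendsto_atTop.eventually hr'] with n hn
  exact (h.invFunOn_apply _ (hn (mem_ball_self hr))).2.symm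

end ConvData

/-- This is the upper half of Vietoris convergence: compact sets disjoint from `K` are eventually
disjoint from the complements. The lower half, in `inter_nonempty_of_hausdorffLimit`, says that
every point of `K` is approached by them. -/
theorem sphereCompl_subset_of_hausdorffLimit {A : ℕ → Set (OnePoint ℂ)} {K : Set (OnePoint ℂ)}
    (h : Tendsto A atTop (@nhds _ (TopologicalSpace.vietoris (OnePoint ℂ)) K))
    {U : Set (OnePoint ℂ)} (hU : IsOpen U) (hK : K ⊆ U) : ∀ᶠ n in atTop, A n ⊆ U := by
  let _ := TopologicalSpace.vietoris (OnePoint ℂ)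
  exact h.eventually (hU.powerset_vietoris.mem_nhds hK)

theorem inter_nonempty_of_hausdorffLimit {A : ℕ → Set (OnePoint ℂ)} {K : Set (OnePoint ℂ)}
    (h : Tendsto A atTop (@nhds _ (TopologicalSpace.vietoris (OnePoint ℂ)) K))
    {U : Set (OnePoint ℂ)} (hU : IsOpen U) (hK : (K ∩ U).Nonempty) :
    ∀ᶠ n in atTop, (A n ∩ U).Nonempty := by
  let _ := TopologicalSpace.vietoris (OnePoint ℂ)
  exact h.eventually
    ((TopologicalSpace.vietoris.isOpen_inter_nonempty_of_isOpen hU).mem_nhds hK)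

namespace ConvData

variable {f : ℕ → ℂ → ℂ} {G : ℕ → Set ℂ} {α β : ℕ → EReal} {c l : ℕ → ℝ}
    {ψ : ℕ → ℂ → ℂ} {α' β' : EReal} {c' l' : ℝ} {Ψ : ℂ → ℂ}

theorem image_eq_connectedComponentIn (h : ConvData f G α β c l ψ α' β' c' l')
    (hΨ : ∀ ζ ∈ rootDomain 3 (realIoo α' β') c', ContConvAt ψ Ψ ζ) {K : Set (OnePoint ℂ)}
    (hK : IsHausdorffLimitPoint (fun n => sphereCompl (G n)) K) :
    (fun z : ℂ => (z : OnePoint ℂ)) '' (Ψ '' rootDomain 3 (realIoo α' β') c') =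
      connectedComponentIn Kᶜ ((0 : ℂ) : OnePoint ℂ) := by
  obtain ⟨hKc, φ, hφ, hlim⟩ := hK
  have hWo := isOpen_rootDomain 3 (isOpen_realIoo α' β') c'
  have hd := h.differentiableOn_limit hΨ
  have hGo : IsOpen (Ψ '' rootDomain 3 (realIoo α' β') c') :=
    isOpen_image_of_injOn hWo hd (h.injOn_limit hΨ) hWo subset_rfl
  have hinf : (OnePoint.infty : OnePoint ℂ) ∈ K := by
    by_contra hnot
    obtain ⟨n, hn⟩ := (sphereCompl_subset_of_hausdorffLimit hlim
      (isOpen_compl_singleton (x := (OnePoint.infty : OnePoint ℂ)))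
      (fun x hx hx' => hnot (hx' ▸ hx))).exists
    refine hn (show OnePoint.infty ∈ sphereCompl (G (φ n)) from ?_) rfl
    rintro ⟨z, -, hz⟩
    exact OnePoint.coe_ne_infty z hz
  have h0 : (0 : ℂ) ∈ Ψ '' rootDomain 3 (realIoo α' β') c' :=
    ⟨0, h.zero_mem_limit, h.limit_zero hΨ⟩
  have hopen : IsOpen ((fun z : ℂ => (z : OnePoint ℂ)) '' (Ψ '' rootDomain 3 (realIoo α' β') c')) :=
    OnePoint.isOpenEmbedding_coe.isOpenMap _ hGo
  have hsubK : (fun z : ℂ => (z : OnePoint ℂ)) '' (Ψ '' rootDomain 3 (realIoo α' β') c') ⊆ Kᶜ := by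
    rintro _ ⟨z, hz, rfl⟩ hzK
    obtain ⟨r, hr, hr'⟩ := h.exists_ball_subset_dom hΨ hz
    obtain ⟨n, hn, hn'⟩ := ((inter_nonempty_of_hausdorffLimit hlim
      (OnePoint.isOpenEmbedding_coe.isOpenMap _ (isOpen_ball (x := z) (ε := r)))
      ⟨(z : OnePoint ℂ), hzK, mem_image_of_mem _ (mem_ball_self hr)⟩).and
      (hφ.tendsto_atTop.eventually hr')).exists
    obtain ⟨_, hx, y, hy, rfl⟩ := hn
    exact hx ⟨y, hn' hy, rfl⟩
  refine subset_antisymm ?_ ?_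
  · refine IsPreconnected.subset_connectedComponentIn ?_ (mem_image_of_mem _ h0) hsubK
    exact (h.isPreconnected_limit.image Ψ hd.continuousOn).image _
      OnePoint.continuous_coe.continuousOn
  · refine isPreconnected_connectedComponentIn.subset_of_closure_inter_subset hopen
      ⟨_, mem_connectedComponentIn (hsubK (mem_image_of_mem _ h0)), mem_image_of_mem _ h0⟩ ?_
    rintro x ⟨hxcl, hxcomp⟩
    have hxK : x ∉ K := connectedComponentIn_subset _ _ hxcomp
    induction x using OnePoint.rec with
    | infty => exact absurd hinf hxK
    | coe z =>
      refine mem_image_of_mem _ ?_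
      have hzcl : z ∈ closure (Ψ '' rootDomain 3 (realIoo α' β') c') := by
        rw [OnePoint.isOpenEmbedding_coe.isInducing.closure_eq_preimage_closure_image]
        exact hxcl
      have hopenK : IsOpen ((fun z : ℂ => (z : OnePoint ℂ)) ⁻¹' Kᶜ) :=
        hKc.isClosed.isOpen_compl.preimage OnePoint.continuous_coe
      obtain ⟨r, hr, hr'⟩ := Metric.isOpen_iff.1 hopenK z hxK
      -- Since `z` is not in `K`, a closed disc about it is disjoint from `K` and hence eventually
      -- inside `G (φ n)`, which is what the boundary point lemma requires.
      have hcomp : IsCompact ((fun z : ℂ => (z : OnePoint ℂ)) '' closedBall z (r / 2)) :=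
        (isCompact_closedBall z (r / 2)).image OnePoint.continuous_coe
      have hev := sphereCompl_subset_of_hausdorffLimit hlim hcomp.isClosed.isOpen_compl (by
        rintro x hx ⟨y, hy, rfl⟩
        exact hr' (closedBall_subset_ball (half_lt_self hr) hy) hx)
      refine (h.subseq hφ).mem_image_limit_of_mem_closure
        (fun ζ hζ => (hΨ ζ hζ).comp_strictMono hφ) hzcl (half_pos hr) ?_
      filter_upwards [hev] with n hn y hy
      by_contra hyG
      refine hn (show (y : OnePoint ℂ) ∈ sphereCompl (G (φ n)) from ?_)
        (mem_image_of_mem _ (ball_subset_closedBall hy))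
      rintro ⟨w, hw, hwy⟩
      rw [OnePoint.coe_injective hwy] at hw
      exact hyG hw

theorem convergesTo (h : ConvData f G α β c l ψ α' β' c' l')
    (hΨ : ∀ ζ ∈ rootDomain 3 (realIoo α' β') c', ContConvAt ψ Ψ ζ) {P : ℂ → ℂ}
    (hP : ∀ ζ ∈ rootDomain 3 (realIoo α' β') c', P (Ψ ζ) = ζ) :
    ConvergesTo (fun n => ⟨G n, 0, f n⟩)
      ⟨Ψ '' rootDomain 3 (realIoo α' β') c', 0, fun z => P z ^ 3 + c'⟩ := by
  refine ⟨⟨tendsto_const_nhds, ⟨0, h.zero_mem_limit, h.limit_zero hΨ⟩, fun K hK =>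
    h.image_eq_connectedComponentIn hΨ hK⟩, fun L hL hLc => ⟨?_, ?_⟩⟩
  · exact eventually_subset_of_forall_ball hLc fun z hz => h.exists_ball_subset_dom hΨ (hL hz)
  · exact (tendstoLocallyUniformlyOn_iff_tendstoUniformlyOn_of_compact hLc).1
      (tendstoLocallyUniformlyOn_of_contConvAt fun z hz => h.contConvAt_map hΨ hP (hL hz))

end ConvData

/-! ### Passing the bounds and the derivative at `1` to the limit -/

theorem IsEpsteinMap.derivWithin_eq {g : ℝ → ℝ} {J : Set ℝ} {G : Set ℂ} {f : ℂ → ℂ}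
    (h : IsEpsteinMap 1 g J G f) : derivWithin g (uIcc 0 1) 1 = (deriv f 1).re := by
  have m1 : (1 : ℝ) ∈ uIcc (0 : ℝ) 1 := right_mem_uIcc
  have hd : HasDerivAt f (deriv f 1) ((1 : ℝ) : ℂ) := by
    have h1 : ((1 : ℝ) : ℂ) ∈ G := h.subset_dom 1 m1
    simpa using (h.covering.analytic.differentiableAt (h.isOpen_dom.mem_nhds h1)).hasDerivAt
  have hu : UniqueDiffWithinAt ℝ (uIcc (0 : ℝ) 1) 1 := by
    rw [uIcc_of_le zero_le_one]
    exact uniqueDiffOn_Icc zero_lt_one 1 (by simp)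
  refine (hd.real_of_complex.hasDerivWithinAt.congr (fun x hx => ?_) ?_).derivWithin hu
  · rw [h.extends_map x hx, Complex.ofReal_re]
  · rw [h.extends_map 1 m1, Complex.ofReal_re]

theorem IsEpsteinMap.image_eq {g : ℝ → ℝ} {J : Set ℝ} {G : Set ℂ} {f : ℂ → ℂ}
    (h : IsEpsteinMap 1 g J G f) : g 0 < g 1 ∧ g '' uIcc 0 1 = Icc (g 0) (g 1) := by
  have hlt : g 0 < g 1 := h.strictMono left_mem_uIcc right_mem_uIcc zero_lt_one
  refine ⟨hlt, ?_⟩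
  rw [h.continuousOn.image_uIcc_of_monotoneOn h.strictMono.monotoneOn, uIcc_of_le hlt.le]

/-- Limits preserve only weak inequalities with the endpoints; strictness returns by comparing each
point with others of the open interval on both sides. -/
theorem Ioo_subset_realIoo_of_tendsto {α β : ℕ → EReal} {a b : ℕ → ℝ} {α' β' : EReal} {a' b' : ℝ}
    (hα : Tendsto α atTop (𝓝 α')) (hβ : Tendsto β atTop (𝓝 β')) (ha : Tendsto a atTop (𝓝 a'))
    (hb : Tendsto b atTop (𝓝 b')) (h : ∀ n, Ioo (a n) (b n) ⊆ realIoo (α n) (β n)) :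
    Ioo a' b' ⊆ realIoo α' β' := by
  have key : ∀ x ∈ Ioo a' b', α' ≤ (x : EReal) ∧ (x : EReal) ≤ β' := by
    intro x hx
    have hev : ∀ᶠ n in atTop, x ∈ realIoo (α n) (β n) := by
      filter_upwards [ha.eventually (gt_mem_nhds hx.1), hb.eventually (lt_mem_nhds hx.2)]
        with n h1 h2 using h n ⟨h1, h2⟩
    exact ⟨le_of_tendsto hα (hev.mono fun n hn => hn.1.le),
      ge_of_tendsto hβ (hev.mono fun n hn => hn.2.le)⟩
  intro x hx
  obtain ⟨y, hy, hyx⟩ := exists_between hx.1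
  obtain ⟨z, hxz, hz⟩ := exists_between hx.2
  exact ⟨(key y ⟨hy, hyx.trans hx.2⟩).1.trans_lt (EReal.coe_lt_coe_iff.2 hyx),
    (EReal.coe_lt_coe_iff.2 hxz).trans_le (key z ⟨hx.1.trans hxz, hz⟩).2⟩

theorem exists_subseq_convergesTo {s : ℝ} (hs₀ : 0 < s) {T : ℕ → MarkedMap}
    (hT : ∀ n, T n ∈ closedEpsteinClass s 1) :
    ∃ S ∈ closedEpsteinClass s 1, ∃ φ : ℕ → ℕ, StrictMono φ ∧ ConvergesTo (T ∘ φ) S := by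
  choose hpt g J hE hB hD using hT
  choose α β hαβ using fun n => exists_eq_realIoo (hE n).isOpen_range (hE n).interval_range
  let c : ℕ → ℝ := fun n => g n 0
  let d : ℕ → ℝ := fun n => g n 1
  have hcd : ∀ n, c n < d n := fun n => (hE n).image_eq.1
  have himg : ∀ n, g n '' uIcc 0 1 = Icc (c n) (d n) := fun n => (hE n).image_eq.2
  have hJsub : ∀ n, Icc (c n) (d n) ⊆ J n := fun n => himg n ▸ (hE n).image_subset
  have hbd : ∀ n, (s ≤ 1 / (d n - c n) ∧ 1 / (d n - c n) ≤ s⁻¹) ∧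
      (s ≤ max 0 (max (c n - 1) (-d n)) / (d n - c n) ∧
        max 0 (max (c n - 1) (-d n)) / (d n - c n) ≤ s⁻¹) ∧
      Ioo (c n - s * (d n - c n)) (d n + s * (d n - c n)) ⊆ J n := fun n =>
    (hasBounds_iff (hE n).isOpen_range (hE n).interval_range (hcd n) (himg n) (hJsub n)).1 (hB n)
  have hlow : ∀ n, s ≤ d n - c n := fun n => by
    have h1 := (hbd n).1.2
    rw [one_div] at h1
    exact (inv_le_inv₀ (sub_pos.2 (hcd n)) hs₀).1 h1
  have hup : ∀ n, d n - c n ≤ s⁻¹ := fun n => by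
    have h1 := (hbd n).1.1
    rw [one_div] at h1
    exact (le_inv_comm₀ hs₀ (sub_pos.2 (hcd n))).1 h1
  have hgap : ∀ n, max 0 (max (c n - 1) (-d n)) ≤ s⁻¹ * s⁻¹ := fun n => by
    have h1 := (div_le_iff₀ (sub_pos.2 (hcd n))).1 (hbd n).2.1.2
    exact h1.trans (mul_le_mul_of_nonneg_left (hup n) (inv_nonneg.2 hs₀.le))
  have hc1 : ∀ n, c n - 1 ≤ s⁻¹ * s⁻¹ := fun n =>
    ((le_max_left _ _).trans (le_max_right _ _)).trans (hgap n)
  have hd1 : ∀ n, -d n ≤ s⁻¹ * s⁻¹ := fun n =>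
    ((le_max_right _ _).trans (le_max_right _ _)).trans (hgap n)
  -- The distance bound gives `c ≤ 1 + s⁻¹ * s⁻¹` and `-d ≤ s⁻¹ * s⁻¹`; the length bound `d - c ≤
  -- s⁻¹` gives the two opposite estimates.
  let M : ℝ := 1 + s⁻¹ * s⁻¹ + s⁻¹
  obtain ⟨⟨c', d', α', β'⟩, -, φ₁, hφ₁, hlim⟩ :=
    (((isCompact_Icc (a := -M) (b := M)).prod ((isCompact_Icc (a := -M) (b := M)).prod
      (isCompact_univ.prod isCompact_univ))).tendsto_subseq
      (x := fun n => (c n, d n, α n, β n)) fun n => by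
        have h1 := hc1 n
        have h2 := hd1 n
        have h3 := hup n
        have h4 := hcd n
        have h5 : 0 < s⁻¹ := inv_pos.2 hs₀
        exact ⟨⟨by simp only [M]; linarith, by simp only [M]; linarith⟩,
          ⟨by simp only [M]; linarith, by simp only [M]; linarith⟩, trivial, trivial⟩)
  have tc : Tendsto (fun n => c (φ₁ n)) atTop (𝓝 c') := (continuous_fst.tendsto _).comp hlim
  have td : Tendsto (fun n => d (φ₁ n)) atTop (𝓝 d') :=
    ((continuous_fst.comp continuous_snd).tendsto _).comp hlim
  have tα : Tendsto (fun n => α (φ₁ n)) atTop (𝓝 α') :=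
    ((continuous_fst.comp (continuous_snd.comp continuous_snd)).tendsto _).comp hlim
  have tβ : Tendsto (fun n => β (φ₁ n)) atTop (𝓝 β') :=
    ((continuous_snd.comp (continuous_snd.comp continuous_snd)).tendsto _).comp hlim
  have tdc : Tendsto (fun n => d (φ₁ n) - c (φ₁ n)) atTop (𝓝 (d' - c')) := td.sub tc
  have hpos' : 0 < d' - c' := hs₀.trans_le (ge_of_tendsto' tdc fun n => hlow _)
  let r : ℝ → ℝ := fun x => x ^ ((3 : ℕ) : ℝ)⁻¹
  have hr0 : ∀ x, 0 < x → 0 < r x := fun x hx => Real.rpow_pos_of_pos hx _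
  have hr3 : ∀ x, 0 < x → r x ^ 3 = x := fun x hx =>
    Real.rpow_inv_natCast_pow hx.le (by norm_num)
  choose ψ hψ using fun n => (hE n).exists_uniformizes (hr0 _ (sub_pos.2 (hcd n)))
    (hr3 _ (sub_pos.2 (hcd n)))
  have hspace : Ioo (c' - s * (d' - c')) (d' + s * (d' - c')) ⊆ realIoo α' β' :=
    Ioo_subset_realIoo_of_tendsto tα tβ (tc.sub (tdc.const_mul s)) (td.add (tdc.const_mul s))
      fun n => hαβ (φ₁ n) ▸ (hbd (φ₁ n)).2.2
  -- The limit of `J` stays inside the open limit interval because the space `s * (d' - c')` on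
  -- either side is positive.
  have hsub' : Icc c' d' ⊆ realIoo α' β' := fun x hx =>
    hspace ⟨by linarith [hx.1, mul_pos hs₀ hpos'], by linarith [hx.2, mul_pos hs₀ hpos']⟩
  have hr3' : r (d' - c') ^ 3 + c' = d' := by rw [hr3 _ hpos']; ring
  have h : ConvData (fun n => (T (φ₁ n)).map) (fun n => (T (φ₁ n)).dom) (fun n => α (φ₁ n))
      (fun n => β (φ₁ n)) (fun n => c (φ₁ n)) (fun n => r (d (φ₁ n) - c (φ₁ n)))
      (fun n => ψ (φ₁ n)) α' β' c' (r (d' - c')) := by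
    refine ⟨fun n => hαβ (φ₁ n) ▸ hψ (φ₁ n), fun n => hr0 _ (sub_pos.2 (hcd _)), fun n => ?_,
      tα, tβ, tc, tdc.rpow_const (Or.inl hpos'.ne'), hr0 _ hpos', hr3'.symm ▸ hsub'⟩
    rw [hr3 _ (sub_pos.2 (hcd _)), sub_add_cancel, ← hαβ]
    exact hJsub _
  obtain ⟨φ₂, hφ₂, Ψ, hΨ⟩ := exists_subseq_contConvAt
    (isOpen_rootDomain 3 (isOpen_realIoo α' β') c') fun ζ hζ => h.evBddAt hζ
  have h2 := h.subseq hφ₂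
  have hdΨ := h2.differentiableOn_limit hΨ
  have hiΨ := h2.injOn_limit hΨ
  let P : ℂ → ℂ := Function.invFunOn Ψ (rootDomain 3 (realIoo α' β') c')
  have hP : ∀ ζ ∈ rootDomain 3 (realIoo α' β') c', P (Ψ ζ) = ζ := hiΨ.leftInvOn_invFunOn
  obtain ⟨hE', hP0, hP1⟩ := exists_isEpsteinMap (isOpen_realIoo α' β') (ordConnected_realIoo α' β')
    h.pos' h.sub' hdΨ hiΨ (h2.limit_zero hΨ) (h2.limit_one hΨ) (fun t ht => h2.im_limit hΨ ht)
    (h2.mono_limit hΨ) hP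
  refine ⟨⟨Ψ '' rootDomain 3 (realIoo α' β') c', 0, fun z => P z ^ 3 + c'⟩,
    ⟨rfl, _, _, hE', ?_, ?_⟩, φ₁ ∘ φ₂, hφ₁.comp hφ₂, ?_⟩
  · have himg' := hE'.image_eq.2
    have e0 : (P ((0 : ℝ) : ℂ) ^ 3 + (c' : ℂ)).re = c' := by
      rw [Complex.ofReal_zero, hP0]; simp
    have e1 : (P ((1 : ℝ) : ℂ) ^ 3 + (c' : ℂ)).re = d' := by
      rw [Complex.ofReal_one, hP1, ← Complex.ofReal_pow, ← Complex.ofReal_add, Complex.ofReal_re,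
        hr3']
    rw [e0, e1] at himg'
    have t1 : Tendsto (fun n => 1 / (d (φ₁ n) - c (φ₁ n))) atTop (𝓝 (1 / (d' - c'))) :=
      tendsto_const_nhds.div tdc hpos'.ne'
    have t2 : Tendsto (fun n => max 0 (max (c (φ₁ n) - 1) (-d (φ₁ n))) / (d (φ₁ n) - c (φ₁ n)))
        atTop (𝓝 (max 0 (max (c' - 1) (-d')) / (d' - c'))) :=
      (tendsto_const_nhds.max ((tc.sub_const 1).max td.neg)).div tdc hpos'.ne'
    exact (hasBounds_iff (isOpen_realIoo α' β') (ordConnected_realIoo α' β') (sub_pos.1 hpos')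
      himg' hsub').2
      ⟨⟨ge_of_tendsto' t1 fun n => (hbd _).1.1, le_of_tendsto' t1 fun n => (hbd _).1.2⟩,
        ⟨ge_of_tendsto' t2 fun n => (hbd _).2.1.1, le_of_tendsto' t2 fun n => (hbd _).2.1.2⟩,
        hspace⟩
  · rw [hE'.derivWithin_eq]
    have hm1 : (1 : ℂ) ∈ Ψ '' rootDomain 3 (realIoo α' β') c' := by
      simpa using hE'.subset_dom 1 right_mem_uIcc
    have hev : EvDiffAt (fun n => (T (φ₁ (φ₂ n))).map) 1 := by
      obtain ⟨ρ, hρ, hρ'⟩ := h2.exists_ball_subset_dom hΨ hm1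
      exact ⟨ρ, hρ, hρ'.mono fun n hn => (hE _).covering.analytic.mono hn⟩
    have ht := (differentiableAt_of_contConvAt hE'.isOpen_dom
      (fun z hz => h2.contConvAt_map hΨ hP hz) hm1 hev).2
    -- The derivative at `1` is the real part of a complex derivative, so it converges with the
    -- maps; only the weak inequality survives.
    refine ge_of_tendsto' ((Complex.continuous_re.tendsto _).comp ht) fun n => ?_
    exact (hD (φ₁ (φ₂ n))).trans_eq (hE (φ₁ (φ₂ n))).derivWithin_eq
  · have hTeq : T ∘ (φ₁ ∘ φ₂) = fun n => ⟨(T (φ₁ (φ₂ n))).dom, 0, (T (φ₁ (φ₂ n))).map⟩ :=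
      funext fun n => by rw [← hpt (φ₁ (φ₂ n))]; rfl
    rw [hTeq]
    exact h2.convergesTo hΨ hP

end Epstein

theorem mainTheorem5 (s : ℝ) (hs₀ : 0 < s) (hs₁ : s < 1) :
    (∀ T : ℕ → Epstein.MarkedMap, (∀ n, T n ∈ Epstein.epsteinClass s 1) →
      ∃ S ∈ Epstein.closedEpsteinClass s 1, ∃ φ : ℕ → ℕ,
        StrictMono φ ∧ Epstein.ConvergesTo (T ∘ φ) S) ∧
    (∀ T : ℕ → Epstein.MarkedMap, (∀ n, T n ∈ Epstein.closedEpsteinClass s 1) →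
      ∃ S ∈ Epstein.closedEpsteinClass s 1, ∃ φ : ℕ → ℕ,
        StrictMono φ ∧ Epstein.ConvergesTo (T ∘ φ) S) := by
  refine ⟨fun T hT => Epstein.exists_subseq_convergesTo hs₀ fun n => ?_,
    fun T hT => Epstein.exists_subseq_convergesTo hs₀ hT⟩
  obtain ⟨h₁, g, J, h₂, h₃, h₄⟩ := hT n
  exact ⟨h₁, g, J, h₂, h₃, h₄.le⟩
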